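/- **Setting.** Let $X$ be a countable set, $m\colon X\to(0,\infty)$ (with $m(A)=\sum_{x\in A}m(x)$), and $b\colon X\times X\to[0,\infty)$ symmetric with $b(x,x)=0$ and $\sum_y b(x,y)<\infty$ for all $x$; write $x\sim y$ if $b(x,y)>0$. Let $\rho$ be a pseudo-metric on $X$, not identically zero, that is intrinsic, i.e. $\sum_y b(x,y)\rho(x,y)^2\le m(x)$ for all $x$, and a path metric, i.e. for some $w\colon X\times X\to[0,\infty]$ with $w(x,y)<\infty$ iff $x\sim y$ we have $\rho(x,y)=\inf\sum_j w(x_{j-1},x_j)$ over all paths $x=x_0\sim\dots\sim x_k=y$. Let $B_x(r)=\{y:\rho(x,y)\le r\}$ and $s_x(r)=\sup\{\rho(y,z): b(y,z)>0,\ (y\in B_x(r),z\notin B_x(r))\text{ or }(y=x,z\ne x)\}$. Assume that all balls $B_x(r)$ are finite and that $S=\sup_{x\in X,r\ge0}s_x(r)<\infty$. Let $\Delta f(x)=\frac1{m(x)}\sum_y b(x,y)(f(x)-f(y))$, let $\Lambda$ be the infimum of the spectrum of the Friedrichs extension in $\ell^2(X,m)$ of $\Delta$ restricted to finitely supported functions,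 let $p_t(x,y)$ be the minimal nonnegative fundamental solution of $\partial_tu=-\Delta u$ on $[0,\infty)\times X$ (with $p_0(x,y)=\mathbf 1_{x=y}/m(y)$), and $|\nabla f|(x)=\big(\frac1{m(x)}\sum_yb(x,y)(f(x)-f(y))^2\big)^{1/2}$. Norms $\|\cdot\|_q$ are those of $\ell^q(X,m)$, and $\|f\|_W=\sup_W|f|\in[0,\infty]$. We write $a\vee b=\max\{a,b\}$ and $a\wedge b=\min\{a,b\}$. Let $B\subset X$, $R_2\ge R_1\ge0$. We say that: * $S_\phi(n,R_1,R_2)$ holds in $B$ if for all $x\in B$, $r\in[R_1,R_2]$, $r>0$, and all $u\colon X\to\mathbb R$ supported in $B_x(r)$, $$\frac{m(B_x(r))^{2/n_x(r)}}{\phi_x(r)r^2}\|u\|^2_{\frac{2n_x(r)}{n_x(r)-2}}\le\||\nabla u|\|_2^2+\frac1{r^2}\|u\|_2^2;$$ * $G_\Psi(N,R_1,R_2)$ holds in $B$ if for all $t>0$ with $t\ge R_1^2$ and all $x,y\in B$, with $\tau=\sqrt t\wedge R_2$ and $N_{xy}=\frac12(N_x(\tau)+N_y(\tau))$, $$p_t(x,y)\le\Psi_x(\tau)\Psi_y(\tau)\frac{\big(1\vee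 S^{-2}(\sqrt{t^2+\rho(x,y)^2S^2}-t)\big)^{N_{xy}/2}}{\sqrt{m(B_x(\tau))m(B_y(\tau))}}e^{-\Lambda(t-t\wedge R_2^2)-\zeta(\rho(x,y),t)},$$ where $\zeta(r,t)=\frac1{S^2}\big(rS\,\mathrm{arsinh}(\tfrac{rS}t)+t-\sqrt{t^2+r^2S^2}\big)$; * $V_\Phi(d,R_1,R_2)$ holds in $B$ if $m(B_x(r_2))\le\Phi_x^{r_2}(r_1)\big(\frac{r_2}{r_1}\big)^{d_x(r_2)}m(B_x(r_1))$ for all $x\in B$ and $R_1\le r_1\le r_2\le R_2$ with $r_1>0$. **Theorem (Sobolev – variable dimension).** Fix $o\in X$, put $B(r)=B_o(r)$ and $Q(r',r)=B(r)\times[r',r]$. Let $0\le4R_1\le R_2$ and assume $8\|s(r/4)\|_{B(r)}\le r$ for all $r\in[R_1,R_2]$. Let $N,d\colon X\times[R_1,R_2]\to(2,\infty)$, $\Psi\colon X\times[R_1,R_2]\to[1,\infty)$ and $\Phi\colon X\times[R_1,R_2]^2\to[1,\infty)$, $(x,\sigma,\tau)\mapsto\Phi_x^\tau(\sigma)$,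 be such that $G_\Psi(N,R_1,R_2)$ and $V_\Phi(d,R_1,R_2)$ hold in $B(R_2)$. For $r\in[4R_1,R_2]$ let $$D(r)=\sup_{x\in B(r)}d_x(r),\qquad p(r)=\frac2{\ln\big(1+\frac2{D(r)+2}\big)},$$ $$r'=\begin{cases}(\ln r)^{p(r)}/4&\text{if }r\ge\exp(4\vee4R_1)\text{ and }(\ln r)^{p(r)}/4<r,\\ r/4&\text{otherwise.}\end{cases}$$ Then for every function $\gamma\colon[4R_1,R_2]\to[1,\infty)$ and every $n\colon[4R_1,R_2]\to(2,\infty)$ with $$n(r)\ge D(r)\vee\ln\left[1\vee\frac{\|\Psi\|^{10}_{Q(r',r)}\|\Phi^r\|^{10}_{Q(r',r)}}{\gamma(r)}\vee\left(\frac{m(B(r))\,\|\tfrac1m\|_{B(r)}}{\gamma(r)}\right)^{\frac1{\ln(r/r')}}\right],\qquad r\in[4R_1,R_2],$$ the Sobolev inequality $S_\phi(n,4R_1,R_2)$ holds in $\{o\}$ with $$\phi(r)=2^{49+\frac{2D(r)}{D(r)-2}}\,\gamma(r)^{\frac2{D(r)}}.$$ -/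

import Mathlib

open scoped ENNReal

noncomputable section

/-- `‖f‖_W = sup_W |f|`, as an element of `[0, ∞]` (the supremum may be infinite). -/
def supNorm {α : Type*} (f : α → ℝ) (W : Set α) : ℝ≥0∞ :=
  ⨆ a ∈ W, ENNReal.ofReal |f a|

/-- The closed ball `B_x(r)` of a (pseudo-)metric `ρ`. -/
def metricBall {X : Type*} (ρ : X → X → ℝ) (x : X) (r : ℝ) : Set X :=
  {y | ρ x y ≤ r}

/-- The exponent function of the Gaussian bounds, `S` being the global jump size. -/
def gaussExponent (S r t : ℝ) : ℝ :=
  1 / S ^ 2 * (r * S * Real.arsinh (r * S / t) + t - Real.sqrt (t ^ 2 + r ^ 2 * S ^ 2))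

/-- A weighted graph `b` over a discrete measure space `(X, m)`. -/
structure WeightedGraph (X : Type*) where
  m : X → ℝ
  b : X → X → ℝ
  m_pos : ∀ x, 0 < m x
  b_nonneg : ∀ x y, 0 ≤ b x y
  b_symm : ∀ x y, b x y = b y x
  b_self : ∀ x, b x x = 0
  b_summable : ∀ x, Summable (b x)

namespace WeightedGraph

variable {X : Type*} (G : WeightedGraph X)

/-- The combinatorial graph `x ∼ y ↔ b x y > 0`. -/
def toSimpleGraph : SimpleGraph X where
  Adj x y := 0 < G.b x y
  symm := ⟨fun x y h => by rw [G.b_symm y x]; exact h⟩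
  loopless := ⟨fun x h => by rw [G.b_self x] at h; exact lt_irrefl _ h⟩

/-- The measure `m(A) = ∑_{x ∈ A} m(x)` (only used for finite `A`). -/
def vol (A : Set X) : ℝ := ∑' x : A, G.m x

/-- An intrinsic metric: a pseudo-metric, not identically zero, with
`∑_y b(x,y) ρ(x,y)² ≤ m(x)`. -/
structure IsIntrinsicMetric (ρ : X → X → ℝ) : Prop where
  nonneg : ∀ x y, 0 ≤ ρ x y
  self : ∀ x, ρ x x = 0
  symm : ∀ x y, ρ x y = ρ y x
  triangle : ∀ x y z, ρ x z ≤ ρ x y + ρ y z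
  nontrivial : ∃ x y, ρ x y ≠ 0
  summable : ∀ x, Summable fun y => G.b x y * ρ x y ^ 2
  intrinsic : ∀ x, ∑' y, G.b x y * ρ x y ^ 2 ≤ G.m x

/-- `ρ` is a path metric: the infimum of the lengths of paths with respect to some edge
lengths `w`, where `w x y < ∞` exactly for `x ∼ y`. -/
def IsPathMetric (ρ : X → X → ℝ) : Prop :=
  ∃ w : X → X → ℝ≥0∞, (∀ x y, w x y < ⊤ ↔ 0 < G.b x y) ∧
    ∀ x y, ENNReal.ofReal (ρ x y) =
      ⨅ p : G.toSimpleGraph.Walk x y, (p.darts.map fun e => w e.fst e.snd).sum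

/-- The local jump size `s_x(r)`. -/
def jumpSize (ρ : X → X → ℝ) (x : X) (r : ℝ) : ℝ≥0∞ :=
  ⨆ (y : X) (z : X) (_ : 0 < G.b y z ∧
      ((y ∈ metricBall ρ x r ∧ z ∉ metricBall ρ x r) ∨ (y = x ∧ z ≠ x))),
    ENNReal.ofReal (ρ y z)

/-- The global jump size `S = sup_{x ∈ X, r ≥ 0} s_x(r)`. -/
def maxJump (ρ : X → X → ℝ) : ℝ≥0∞ :=
  ⨆ (x : X) (r : ℝ) (_ : 0 ≤ r), G.jumpSize ρ x r

/-- The formal Laplacian `Δ f(x) = m(x)⁻¹ ∑_y b(x,y) (f(x) - f(y))`. -/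
def laplacian (f : X → ℝ) (x : X) : ℝ :=
  1 / G.m x * ∑' y, G.b x y * (f x - f y)

/-- `|∇f|(x)`. -/
def gradNorm (f : X → ℝ) (x : X) : ℝ :=
  Real.sqrt (1 / G.m x * ∑' y, G.b x y * (f x - f y) ^ 2)

/-- The norm of `ℓ^q(X, m)` (only used for finitely supported functions). -/
def lpNorm (q : ℝ) (f : X → ℝ) : ℝ :=
  (∑' x, G.m x * |f x| ^ q) ^ (1 / q)

/-! ### The Friedrichs extension of the Laplacian and the bottom of its spectrum -/

/-- The quadratic form `½ ∑_{x,y} b(x,y) (f(x) - f(y))²`, with values in `[0, ∞]`. -/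
def energy (f : X → ℝ) : ℝ≥0∞ :=
  2⁻¹ * ∑' (x : X) (y : X), ENNReal.ofReal (G.b x y * (f x - f y) ^ 2)

/-- `‖f‖²` in `ℓ²(X, m)`, with values in `[0, ∞]`. -/
def l2Sq (f : X → ℝ) : ℝ≥0∞ :=
  ∑' x, ENNReal.ofReal (G.m x * f x ^ 2)

/-- The form domain of the Friedrichs extension: the closure of the finitely supported
functions with respect to the form norm. -/
def formDomain : Set (X → ℝ) :=
  {f | ∀ ε : ℝ≥0∞, 0 < ε → ∃ φ : X → ℝ, (Function.support φ).Finite ∧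
    G.energy (f - φ) + G.l2Sq (f - φ) < ε}

/-- The graph of the Friedrichs extension of `Δ` restricted to the finitely supported
functions, i.e. of the restriction of its adjoint in `ℓ²(X, m)` to the form domain. -/
def IsFriedrichs (f g : X → ℝ) : Prop :=
  f ∈ G.formDomain ∧ G.l2Sq f < ⊤ ∧ G.l2Sq g < ⊤ ∧
    ∀ φ : X → ℝ, (Function.support φ).Finite →
      ∑' x, G.m x * (f x * G.laplacian φ x) = ∑' x, G.m x * (g x * φ x)

/-- The spectrum of the Friedrichs extension `Δ` (self-adjoint, so the spectrum is real):
all `l` for which `Δ - l` is not a bijection from its domain onto `ℓ²(X, m)`. -/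
def spec : Set ℝ :=
  {l | ¬ ∀ h : X → ℝ, G.l2Sq h < ⊤ → ∃! f : X → ℝ, G.IsFriedrichs f (h + l • f)}

/-- The bottom of the spectrum. -/
def bottomSpec : ℝ := sInf G.spec

/-! ### The heat kernel -/

/-- `u` is a nonnegative solution of the heat equation `∂ₜ u = -Δ u` on `[0, ∞) × X` with
initial value `δ_y / m(y)`. -/
structure IsFundamentalSolution (y : X) (u : ℝ → X → ℝ) : Prop where
  nonneg : ∀ t, 0 ≤ t → ∀ x, 0 ≤ u t x
  heat : ∀ t, 0 ≤ t → ∀ x,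
    HasDerivWithinAt (fun s => u s x) (-(G.laplacian (u t) x)) (Set.Ici 0) t
  initial_self : u 0 y = 1 / G.m y
  initial_ne : ∀ x, x ≠ y → u 0 x = 0

/-- The heat kernel `p_t(x,y)`: the minimal nonnegative fundamental solution, i.e. the
pointwise infimum of all nonnegative fundamental solutions. -/
def heatKernel (t : ℝ) (x y : X) : ℝ≥0∞ :=
  ⨅ (u : ℝ → X → ℝ) (_ : G.IsFundamentalSolution y u), ENNReal.ofReal (u t x)

/-! ### Sobolev inequality, Gaussian bounds and volume doubling -/

/-- The Sobolev inequality `S_φ(n, R₁, R₂)` in `B`. -/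
def Sobolev (ρ : X → X → ℝ) (φ n : X → ℝ → ℝ) (R₁ R₂ : ℝ) (B : Set X) : Prop :=
  ∀ x ∈ B, ∀ r ∈ Set.Icc R₁ R₂, 0 < r →
    ∀ u : X → ℝ, Function.support u ⊆ metricBall ρ x r →
      G.vol (metricBall ρ x r) ^ (2 / n x r) / (φ x r * r ^ 2) *
          G.lpNorm (2 * n x r / (n x r - 2)) u ^ 2
        ≤ G.lpNorm 2 (G.gradNorm u) ^ 2 + 1 / r ^ 2 * G.lpNorm 2 u ^ 2

/-- The Gaussian upper bounds `G_Ψ(n, R₁, R₂)` in `B`. -/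
def GaussianBounds (ρ : X → X → ℝ) (Ψ n : X → ℝ → ℝ) (R₁ R₂ : ℝ) (B : Set X) : Prop :=
  ∀ t : ℝ, 0 < t → R₁ ^ 2 ≤ t → ∀ x ∈ B, ∀ y ∈ B,
    let τ := min (Real.sqrt t) R₂
    let S := (G.maxJump ρ).toReal
    G.heatKernel t x y ≤ ENNReal.ofReal
      (Ψ x τ * Ψ y τ *
        (max 1 (1 / S ^ 2 * (Real.sqrt (t ^ 2 + ρ x y ^ 2 * S ^ 2) - t)) ^
            (((n x τ + n y τ) / 2) / 2) /
          Real.sqrt (G.vol (metricBall ρ x τ) * G.vol (metricBall ρ y τ))) *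
        Real.exp (-(G.bottomSpec * (t - min t (R₂ ^ 2))) - gaussExponent S (ρ x y) t))

/-- The volume doubling property `V_Φ(n, R₁, R₂)` in `B`, where `Φ x r₂ r₁` stands for
`Φ_x^{r₂}(r₁)`; for `r₁ = 0` the condition is void. -/
def VolumeDoubling (ρ : X → X → ℝ) (Φ : X → ℝ → ℝ → ℝ) (n : X → ℝ → ℝ) (R₁ R₂ : ℝ)
    (B : Set X) : Prop :=
  ∀ x ∈ B, ∀ r₁ r₂ : ℝ, 0 < r₁ → R₁ ≤ r₁ → r₁ ≤ r₂ → r₂ ≤ R₂ →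
    G.vol (metricBall ρ x r₂) ≤
      Φ x r₂ r₁ * (r₂ / r₁) ^ n x r₂ * G.vol (metricBall ρ x r₁)

end WeightedGraph

/-! ### The quantities entering the variable dimension -/

/-- `D(r) = ‖d(r)‖_{B_o(r)}`. -/
def dimSup {X : Type*} (ρ : X → X → ℝ) (o : X) (d : X → ℝ → ℝ) (r : ℝ) : ℝ :=
  (supNorm (fun x => d x r) (metricBall ρ o r)).toReal

/-- `p = 2 / ln (1 + 2 / (D + 2))`. -/
def radiusExponent (D : ℝ) : ℝ := 2 / Real.log (1 + 2 / (D + 2))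

open Classical in
/-- The radius `r'`, given the value `D = D(r)`: it is `(ln r)^p / 4` if
`r ≥ exp (4 ∨ 4 R₁)` and this number is below `r`, and it is `r / 4` otherwise. -/
def innerRadius (R₁ D r : ℝ) : ℝ :=
  if Real.exp (max 4 (4 * R₁)) ≤ r ∧ Real.log r ^ radiusExponent D / 4 < r then
    Real.log r ^ radiusExponent D / 4
  else r / 4

/-- The lower bound for the dimension `n(r)`, as an extended real number, where `r'` is the
inner radius; norms over the cylinder `Q(r', r) = B_o(r) × [r', r]`. -/
def dimBound {X : Type*} (G : WeightedGraph X) (ρ : X → X → ℝ) (o : X)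
    (Ψ : X → ℝ → ℝ) (Φ : X → ℝ → ℝ → ℝ) (γ : ℝ → ℝ) (D r' r : ℝ) : EReal :=
  let Q : Set (X × ℝ) := metricBall ρ o r ×ˢ Set.Icc r' r
  max (D : EReal) (ENNReal.log
    (max 1 (max
      (supNorm (fun q : X × ℝ => Ψ q.1 q.2) Q ^ 10 *
          supNorm (fun q : X × ℝ => Φ q.1 r q.2) Q ^ 10 / ENNReal.ofReal (γ r))
      ((ENNReal.ofReal (G.vol (metricBall ρ o r)) *
          supNorm (fun x => 1 / G.m x) (metricBall ρ o r) / ENNReal.ofReal (γ r)) ^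
        (1 / Real.log (r / r'))))))

end

/-!
The proof passes through heat kernel bounds on the diagonal for times `t ≤ r²`, a Faber–Krahn
inequality, and truncation. Put `B = B_o(r)`, `V = m(B)` and `n = n(r)`.

*Heat kernel.* For `y ∈ B` and `0 < t ≤ r²`, either `1 / m(y)` or `p_t(y,y)` is at most
`γ 32ⁿ (r / √t)ⁿ / V`. If `√t ≤ r'`, or if `r'` is comparable to `r`, this holds for `1 / m(y)`,
since the last term in the lower bound on `n` says that `V / m(y) ≤ γ (r / r')ⁿ`. Otherwise the
Gaussian bound on the diagonal and volume doubling around `y` apply, and the powers of `‖Ψ‖` and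
`‖Φ‖` are absorbed by `γ eⁿ` (`dimBound_spec`). Since `ρ` is a path metric with short edges, there
are approximate midpoints, so that `m(B_y(r))` is comparable to `V` with constants that involve
only radii between `r / 4` and `r` (`WeightedGraph.vol_ball_le`).

*Faber–Krahn.* The functions in question live on a finite set, namely `B` together with its
neighbours; balls are finite and edges have bounded length, so the graph is locally finite. On this
set the Dirichlet heat flow is the exponential of a matrix. Its diagonal is bounded by `1 / m` and,
by a minimum principle, by every nonnegative fundamental solution, hence by the heat kernel
(`normSq_flow_single_le`). As the energy decreases along the flow, `‖f‖₂² - ‖P_t f‖₂²` is at most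
`2t` times the energy, while `‖P_t f‖₂²` is bounded by the kernel at time `2t` times `‖f‖₁²`.
Choosing `2t` proportional to `r² (m(supp f) / V)^(2/n)`, or using the term `‖f‖₂² / r²` if this
exceeds `r²`, gives `faberKrahn_of_heatKernel_bound`.

*Sobolev.* Slicing `|u|` at the levels `s 2^k` and applying the Faber–Krahn inequality to each slice
produces a recursion for the measures of the level sets, whose sum is the Sobolev inequality with
the constant `4 · 2^(2n/(n-2))` (`sobolev_of_faberKrahn`).
-/

/-! ### The heat flow of a weighted graph with killing on a finite set -/

/-- The operator `f ↦ m⁻¹ (c f - ∑_y b(·,y) f(y))` on a finite set. For `c x` the full weighted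
degree of `x`, this is the Dirichlet Laplacian of a finite subset of a larger graph. -/
noncomputable def killedLaplacian {ι : Type*} [Fintype ι] (m c : ι → ℝ) (b : ι → ι → ℝ) :
    (ι → ℝ) →L[ℝ] (ι → ℝ) :=
  LinearMap.toContinuousLinearMap
    { toFun := fun f x => (c x * f x - ∑ y, b x y * f y) / m x
      map_add' := fun f g => by
        funext x
        simp only [Pi.add_apply, mul_add, Finset.sum_add_distrib]
        ring
      map_smul' := fun a f => by
        funext x
        simp only [Pi.smul_apply, smul_eq_mul, RingHom.id_apply]
        have : ∑ y, b x y * (a * f y) = a * ∑ y, b x y * f y := by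
          rw [Finset.mul_sum]; exact Finset.sum_congr rfl fun y _ => by ring
        rw [this]; ring }

lemma exists_linear_flow {E : Type*} [NormedAddCommGroup E] [NormedSpace ℝ E] [CompleteSpace E]
    (L : E →L[ℝ] E) :
    ∃ P : ℝ → E →L[ℝ] E, (∀ f, P 0 f = f) ∧
      ∀ f t, HasDerivAt (fun s => P s f) (-(L (P t f))) t := by
  refine ⟨fun t => NormedSpace.exp (t • (-L)), fun f => by simp [NormedSpace.exp_zero],
    fun f t => ?_⟩
  have h := (hasDerivAt_exp_smul_const' (𝕂 := ℝ) (-L) t).clm_apply (hasDerivAt_const t f)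
  simpa using h

section KilledLaplacian

variable {ι : Type*} [Fintype ι] {m c : ι → ℝ} {b : ι → ι → ℝ}

lemma killedLaplacian_apply (f : ι → ℝ) (x : ι) :
    killedLaplacian m c b f x = (c x * f x - ∑ y, b x y * f y) / m x := rfl

lemma sum_killedLaplacian_mul (hm : ∀ x, 0 < m x) (f g : ι → ℝ) :
    ∑ x, m x * (killedLaplacian m c b f x * g x) =
      ∑ x, c x * (f x * g x) - ∑ x, ∑ y, b x y * (f y * g x) := by
  rw [← Finset.sum_sub_distrib]
  refine Finset.sum_congr rfl fun x _ => ?_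
  have : ∑ y, b x y * (f y * g x) = (∑ y, b x y * f y) * g x := by
    rw [Finset.sum_mul]; exact Finset.sum_congr rfl fun y _ => by ring
  rw [killedLaplacian_apply, this]
  have := (hm x).ne'
  field_simp

lemma killedLaplacian_symm (hm : ∀ x, 0 < m x) (hb : ∀ x y, b x y = b y x) (f g : ι → ℝ) :
    ∑ x, m x * (killedLaplacian m c b f x * g x) =
      ∑ x, m x * (f x * killedLaplacian m c b g x) := by
  have h : ∑ x, m x * (f x * killedLaplacian m c b g x) =
      ∑ x, m x * (killedLaplacian m c b g x * f x) :=
    Finset.sum_congr rfl fun x _ => by ring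
  rw [h, sum_killedLaplacian_mul hm, sum_killedLaplacian_mul hm, Finset.sum_comm]
  congr 1
  · exact Finset.sum_congr rfl fun x _ => by ring
  · exact Finset.sum_congr rfl fun x _ => Finset.sum_congr rfl fun y _ => by rw [hb y x]; ring

lemma sum_killedLaplacian_self (hm : ∀ x, 0 < m x) (hb : ∀ x y, b x y = b y x) (f : ι → ℝ) :
    ∑ x, m x * (killedLaplacian m c b f x * f x) =
      2⁻¹ * ∑ x, ∑ y, b x y * (f x - f y) ^ 2 + ∑ x, (c x - ∑ y, b x y) * f x ^ 2 := by
  rw [sum_killedLaplacian_mul hm]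
  have h1 : ∑ x, ∑ y, b x y * (f x - f y) ^ 2 =
      ∑ x, ∑ y, b x y * f x ^ 2 + ∑ x, ∑ y, b x y * f y ^ 2
        - 2 * ∑ x, ∑ y, b x y * (f y * f x) := by
    simp only [Finset.mul_sum, ← Finset.sum_add_distrib, ← Finset.sum_sub_distrib]
    exact Finset.sum_congr rfl fun x _ => Finset.sum_congr rfl fun y _ => by ring
  have h2 : ∑ x, ∑ y, b x y * f y ^ 2 = ∑ x, ∑ y, b x y * f x ^ 2 := by
    rw [Finset.sum_comm]
    exact Finset.sum_congr rfl fun x _ => Finset.sum_congr rfl fun y _ => by rw [hb]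
  have h3 : ∑ x, (c x - ∑ y, b x y) * f x ^ 2 =
      ∑ x, c x * (f x * f x) - ∑ x, ∑ y, b x y * f x ^ 2 := by
    rw [← Finset.sum_sub_distrib]
    exact Finset.sum_congr rfl fun x _ => by rw [← Finset.sum_mul]; ring
  rw [h1, h2, h3]; ring

lemma sum_killedLaplacian_self_nonneg (hm : ∀ x, 0 < m x) (hb : ∀ x y, b x y = b y x)
    (hb0 : ∀ x y, 0 ≤ b x y) (hc : ∀ x, ∑ y, b x y ≤ c x) (f : ι → ℝ) :
    0 ≤ ∑ x, m x * (killedLaplacian m c b f x * f x) := by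
  rw [sum_killedLaplacian_self hm hb]
  refine add_nonneg (mul_nonneg (by norm_num) (Finset.sum_nonneg fun x _ =>
    Finset.sum_nonneg fun y _ => mul_nonneg (hb0 x y) (sq_nonneg _))) (Finset.sum_nonneg
    fun x _ => mul_nonneg (sub_nonneg.2 (hc x)) (sq_nonneg _))

lemma hasDerivAt_sum_mul {v w v' w' : ℝ → ι → ℝ} {t : ℝ} (hv : HasDerivAt v (v' t) t)
    (hw : HasDerivAt w (w' t) t) :
    HasDerivAt (fun s => ∑ x, m x * (v s x * w s x))
      (∑ x, m x * (v' t x * w t x) + ∑ x, m x * (v t x * w' t x)) t := by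
  rw [← Finset.sum_add_distrib]
  refine HasDerivAt.fun_sum fun x _ => ?_
  rw [← mul_add]
  exact ((hasDerivAt_pi.1 hv x).mul (hasDerivAt_pi.1 hw x)).const_mul (m x)

/-- Symmetry and semigroup property of the heat flow in one: `⟨v(s), w(t - s)⟩` does not depend
on `s` for two solutions of the heat equation. -/
lemma heatFlow_pairing_eq (hm : ∀ x, 0 < m x) (hb : ∀ x y, b x y = b y x) {v w : ℝ → ι → ℝ}
    (hv : ∀ t, HasDerivAt v (-(killedLaplacian m c b (v t))) t)
    (hw : ∀ t, HasDerivAt w (-(killedLaplacian m c b (w t))) t) (t : ℝ) :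
    ∑ x, m x * (v (2 * t) x * w 0 x) = ∑ x, m x * (v t x * w t x) := by
  set F : ℝ → ℝ := fun s => ∑ x, m x * (v s x * w (2 * t - s) x) with hF
  have hd : ∀ s, HasDerivAt F 0 s := by
    intro s
    have h1 : HasDerivAt (fun s => w (2 * t - s)) (killedLaplacian m c b (w (2 * t - s))) s := by
      have := (hw (2 * t - s)).scomp s ((hasDerivAt_id s).const_sub (2 * t))
      simpa [Function.comp_def] using this
    have h2 := hasDerivAt_sum_mul (m := m)
      (v' := fun s => -(killedLaplacian m c b (v s)))
      (w' := fun s => killedLaplacian m c b (w (2 * t - s))) (hv s) h1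
    convert h2 using 1
    rw [← killedLaplacian_symm hm hb, ← Finset.sum_add_distrib]
    exact (Finset.sum_eq_zero fun x _ => by simp only [Pi.neg_apply]; ring).symm
  have := is_const_of_deriv_eq_zero (fun s => (hd s).differentiableAt) (fun s => (hd s).deriv)
    (2 * t) t
  simp only [hF] at this
  rw [sub_self, show 2 * t - t = t by ring] at this
  exact this

lemma heatFlow_hasDerivAt_normSq {v : ℝ → ι → ℝ}
    (hv : ∀ t, HasDerivAt v (-(killedLaplacian m c b (v t))) t) (t : ℝ) :
    HasDerivAt (fun s => ∑ x, m x * (v s x * v s x))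
      (-(2 * ∑ x, m x * (killedLaplacian m c b (v t) x * v t x))) t := by
  have h := hasDerivAt_sum_mul (m := m) (v' := fun s => -(killedLaplacian m c b (v s)))
    (w' := fun s => -(killedLaplacian m c b (v s))) (hv t) (hv t)
  convert h using 1
  rw [Finset.mul_sum, ← Finset.sum_add_distrib, ← Finset.sum_neg_distrib]
  exact Finset.sum_congr rfl fun x _ => by simp only [Pi.neg_apply]; ring

lemma heatFlow_normSq_antitone (hm : ∀ x, 0 < m x) (hb : ∀ x y, b x y = b y x)
    (hb0 : ∀ x y, 0 ≤ b x y) (hc : ∀ x, ∑ y, b x y ≤ c x)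
    {v : ℝ → ι → ℝ} (hv : ∀ t, HasDerivAt v (-(killedLaplacian m c b (v t))) t) :
    Antitone fun s => ∑ x, m x * (v s x * v s x) := by
  refine antitone_of_deriv_nonpos
    (fun t => (heatFlow_hasDerivAt_normSq hv t).differentiableAt) fun t => ?_
  rw [(heatFlow_hasDerivAt_normSq hv t).deriv]
  have := sum_killedLaplacian_self_nonneg hm hb hb0 hc (v t)
  linarith

/-- The energy decreases along the heat flow, so that the squared norm drops at most at the
initial rate. -/
lemma heatFlow_normSq_sub_le (hm : ∀ x, 0 < m x) (hb : ∀ x y, b x y = b y x)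
    {v : ℝ → ι → ℝ} (hv : ∀ t, HasDerivAt v (-(killedLaplacian m c b (v t))) t)
    {t : ℝ} (ht : 0 ≤ t) :
    ∑ x, m x * (v 0 x * v 0 x) ≤ ∑ x, m x * (v t x * v t x) +
      2 * t * ∑ x, m x * (killedLaplacian m c b (v 0) x * v 0 x) := by
  set q : ℝ → ℝ := fun s => ∑ x, m x * (killedLaplacian m c b (v s) x * v s x) with hq
  have hqd : ∀ s, HasDerivAt q (-(2 * ∑ x, m x * (killedLaplacian m c b (v s) x *
      killedLaplacian m c b (v s) x))) s := by
    intro s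
    have h1 : HasDerivAt (fun s => killedLaplacian m c b (v s))
        (-(killedLaplacian m c b (killedLaplacian m c b (v s)))) s := by
      have := ((killedLaplacian m c b).hasFDerivAt (x := v s)).comp_hasDerivAt s (hv s)
      simpa [Function.comp_def] using this
    have h2 := hasDerivAt_sum_mul (m := m)
      (v' := fun s => -(killedLaplacian m c b (killedLaplacian m c b (v s))))
      (w' := fun s => -(killedLaplacian m c b (v s))) h1 (hv s)
    convert h2 using 1
    have h3 : ∑ x, m x * ((-(killedLaplacian m c b (killedLaplacian m c b (v s)))) x * v s x) =
        -∑ x, m x * (killedLaplacian m c b (killedLaplacian m c b (v s)) x * v s x) := by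
      rw [← Finset.sum_neg_distrib]
      exact Finset.sum_congr rfl fun x _ => by simp only [Pi.neg_apply]; ring
    rw [h3, killedLaplacian_symm hm hb (killedLaplacian m c b (v s)) (v s),
      Finset.mul_sum, ← Finset.sum_neg_distrib,
      ← Finset.sum_neg_distrib, ← Finset.sum_add_distrib]
    exact Finset.sum_congr rfl fun x _ => by simp only [Pi.neg_apply]; ring
  have hqa : Antitone q := by
    refine antitone_of_deriv_nonpos (fun s => (hqd s).differentiableAt) fun s => ?_
    rw [(hqd s).deriv]
    have : 0 ≤ ∑ x, m x * (killedLaplacian m c b (v s) x * killedLaplacian m c b (v s) x) :=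
      Finset.sum_nonneg fun x _ => mul_nonneg (hm x).le (mul_self_nonneg _)
    linarith
  have hgd : ∀ s, HasDerivAt (fun s => ∑ x, m x * (v s x * v s x) + 2 * s * q 0)
      (-(2 * q s) + 2 * q 0) s := fun s =>
    (heatFlow_hasDerivAt_normSq hv s).add
      (by simpa using ((hasDerivAt_id s).const_mul 2).mul_const (q 0))
  have hmono : MonotoneOn (fun s => ∑ x, m x * (v s x * v s x) + 2 * s * q 0) (Set.Ici 0) := by
    refine monotoneOn_of_deriv_nonneg (convex_Ici 0)
      (fun s _ => (hgd s).continuousAt.continuousWithinAt)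
      (fun s _ => (hgd s).differentiableAt.differentiableWithinAt) fun s hs => ?_
    rw [interior_Ici] at hs
    rw [(hgd s).deriv]
    have := hqa (le_of_lt hs)
    linarith
  have := hmono (Set.mem_Ici.2 le_rfl) (Set.mem_Ici.2 ht) ht
  simpa using this

lemma hasDerivAt_min_zero_sq (x : ℝ) : HasDerivAt (fun y : ℝ => min y 0 ^ 2) (2 * min x 0) x := by
  rcases lt_trichotomy x 0 with h | rfl | h
  · rw [min_eq_left h.le]
    have h1 : HasDerivAt (fun y : ℝ => y ^ 2) (2 * x) x := by simpa using hasDerivAt_pow 2 x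
    refine h1.congr_of_eventuallyEq ?_
    filter_upwards [Iio_mem_nhds h] with y hy
    rw [min_eq_left (le_of_lt hy)]
  · rw [hasDerivAt_iff_isLittleO]
    have h1 : (fun y : ℝ => y ^ 2) =o[nhds 0] fun y => y := by
      simpa using Asymptotics.isLittleO_pow_id (𝕜 := ℝ) (n := 2) one_lt_two
    refine Asymptotics.IsBigO.trans_isLittleO ?_ (by simpa using h1)
    refine Asymptotics.IsBigO.of_bound 1 (Filter.Eventually.of_forall fun y => ?_)
    simp only [min_self, sub_zero, ne_eq, OfNat.ofNat_ne_zero, not_false_eq_true, zero_pow,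
      mul_zero, smul_zero, one_mul, Real.norm_eq_abs, abs_pow, sq_abs]
    rcases le_total y 0 with h | h
    · rw [min_eq_left h]
    · rw [min_eq_right h]; nlinarith [sq_nonneg y]
  · rw [min_eq_right h.le, mul_zero]
    refine (hasDerivAt_const x (0 : ℝ)).congr_of_eventuallyEq ?_
    filter_upwards [Ioi_mem_nhds h] with y hy
    rw [min_eq_right (le_of_lt hy)]; simp

/-- Minimum principle: a supersolution of the heat equation which is nonnegative at time zero
stays nonnegative, because the squared norm of its negative part decreases. -/
lemma killedLaplacian_minimum_principle (hm : ∀ x, 0 < m x) (hb : ∀ x y, b x y = b y x)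
    (hb0 : ∀ x y, 0 ≤ b x y) (hc : ∀ x, ∑ y, b x y ≤ c x) {w w' : ℝ → ι → ℝ}
    (hw : ∀ t, 0 ≤ t → ∀ x, HasDerivWithinAt (fun s => w s x) (w' t x) (Set.Ici 0) t)
    (hsuper : ∀ t, 0 ≤ t → ∀ x, -(killedLaplacian m c b (w t) x) ≤ w' t x)
    (h0 : ∀ x, 0 ≤ w 0 x) {t : ℝ} (ht : 0 ≤ t) (x : ι) : 0 ≤ w t x := by
  set N : ℝ → ℝ := fun s => ∑ x, m x * min (w s x) 0 ^ 2 with hN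
  have hNd : ∀ s, 0 ≤ s → HasDerivWithinAt N (∑ x, m x * (2 * min (w s x) 0 * w' s x))
      (Set.Ici 0) s := by
    intro s hs
    refine HasDerivWithinAt.fun_sum fun x _ => HasDerivWithinAt.const_mul _ ?_
    exact (hasDerivAt_min_zero_sq (w s x)).comp_hasDerivWithinAt s (hw s hs x)
  have hle : ∀ s, 0 ≤ s → ∑ x, m x * (2 * min (w s x) 0 * w' s x) ≤ 0 := by
    intro s hs
    set g : ι → ℝ := fun x => min (w s x) 0
    set h : ι → ℝ := fun x => max (w s x) 0
    have hgh : w s = h + g := by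
      funext x; simp only [Pi.add_apply, g, h]; rw [add_comm, min_add_max, add_zero]
    have h1 : ∑ x, m x * (2 * min (w s x) 0 * w' s x) ≤
        ∑ x, -(2 * (m x * (killedLaplacian m c b (w s) x * g x))) := by
      refine Finset.sum_le_sum fun x _ => ?_
      have hg0 : g x ≤ 0 := min_le_right _ _
      have := mul_nonneg (hm x).le (mul_nonneg (neg_nonneg.2 hg0)
        (sub_nonneg.2 (hsuper s hs x)))
      change m x * (2 * g x * w' s x) ≤ _
      nlinarith
    rw [Finset.sum_neg_distrib, ← Finset.mul_sum] at h1
    have h2 : ∑ x, m x * (killedLaplacian m c b (w s) x * g x) =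
        ∑ x, m x * (killedLaplacian m c b h x * g x) +
          ∑ x, m x * (killedLaplacian m c b g x * g x) := by
      rw [hgh, map_add, ← Finset.sum_add_distrib]
      exact Finset.sum_congr rfl fun x _ => by simp only [Pi.add_apply]; ring
    have h3 := sum_killedLaplacian_self_nonneg hm hb hb0 hc g
    have h4 : 0 ≤ ∑ x, m x * (killedLaplacian m c b h x * g x) := by
      rw [sum_killedLaplacian_mul hm]
      have h5 : ∑ x, c x * (h x * g x) = 0 := by
        refine Finset.sum_eq_zero fun x _ => ?_
        rcases le_total (w s x) 0 with hx | hx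
        · simp [h, max_eq_right hx]
        · simp [g, min_eq_right hx]
      have h6 : ∑ x, ∑ y, b x y * (h y * g x) ≤ 0 :=
        Finset.sum_nonpos fun x _ => Finset.sum_nonpos fun y _ =>
          mul_nonpos_of_nonneg_of_nonpos (hb0 x y)
            (mul_nonpos_of_nonneg_of_nonpos (le_max_right _ _) (min_le_right _ _))
      linarith
    linarith
  have hanti : AntitoneOn N (Set.Ici 0) := by
    refine antitoneOn_of_hasDerivWithinAt_nonpos (f' := fun s =>
      ∑ x, m x * (2 * min (w s x) 0 * w' s x)) (convex_Ici 0)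
      (fun s hs => (hNd s hs).continuousWithinAt)
      (fun s hs => (hNd s (interior_subset hs)).mono interior_subset)
      (fun s hs => hle s (interior_subset hs))
  have hN0 : N 0 = 0 := Finset.sum_eq_zero fun x _ => by rw [min_eq_right (h0 x)]; simp
  have h1 : N t ≤ 0 := hN0 ▸ hanti (Set.mem_Ici.2 le_rfl) (Set.mem_Ici.2 ht) ht
  have h2 : m x * min (w t x) 0 ^ 2 ≤ N t := Finset.single_le_sum
    (f := fun x => m x * min (w t x) 0 ^ 2)
    (fun y _ => mul_nonneg (hm y).le (sq_nonneg _)) (Finset.mem_univ x)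
  have h3 : min (w t x) 0 ^ 2 ≤ 0 := by
    by_contra h
    have := mul_pos (hm x) (not_le.1 h)
    linarith
  have h4 : min (w t x) 0 = 0 :=
    (pow_eq_zero_iff two_ne_zero).1 (le_antisymm h3 (sq_nonneg _))
  exact min_eq_right_iff.1 h4

end KilledLaplacian

/-! ### From the Faber–Krahn to the Sobolev inequality by truncation -/

/-- Slicing a real function into layers does not increase squared differences. -/
lemma sum_layer_sub_sq_le {l : ℕ → ℝ} (hl : Monotone l) (n : ℕ) (a b : ℝ) :
    ∑ k ∈ Finset.range n, ((min a (l (k + 1)) - min a (l k)) -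
      (min b (l (k + 1)) - min b (l k))) ^ 2 ≤ (a - b) ^ 2 := by
  wlog hab : b ≤ a generalizing a b with H
  · have := H b a (le_of_not_ge hab)
    rw [← neg_sub b a, neg_sq]
    refine le_trans (le_of_eq (Finset.sum_congr rfl fun k _ => ?_)) this
    ring
  have hpos : ∀ k ∈ Finset.range n, 0 ≤ (min a (l (k + 1)) - min a (l k)) -
      (min b (l (k + 1)) - min b (l k)) := by
    intro k _
    have := hl (Nat.le_succ k)
    simp only [Nat.succ_eq_add_one] at this
    rcases le_total a (l (k + 1)) with h1 | h1 <;> rcases le_total a (l k) with h2 | h2 <;>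
    rcases le_total b (l (k + 1)) with h3 | h3 <;> rcases le_total b (l k) with h4 | h4 <;>
    simp only [h1, h2, h3, h4, min_eq_left, min_eq_right] <;> linarith
  refine (Finset.sum_sq_le_sq_sum_of_nonneg hpos).trans ?_
  refine pow_le_pow_left₀ (Finset.sum_nonneg hpos) ?_ 2
  rw [Finset.sum_sub_distrib, Finset.sum_range_sub (fun k => min a (l k)),
    Finset.sum_range_sub (fun k => min b (l k))]
  have h1 : min b (l 0) ≤ min a (l 0) := min_le_min_right _ hab
  have h2 : min a (l n) - min b (l n) ≤ a - b := by
    rcases le_total a (l n) with h1 | h1 <;> rcases le_total b (l n) with h3 | h3 <;>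
    simp only [h1, h3, min_eq_left, min_eq_right] <;> linarith
  linarith

section FaberKrahn

variable {ι : Type*} [Fintype ι] {m : ι → ℝ} {b : ι → ι → ℝ}

/-- Faber–Krahn implies Sobolev for nonnegative functions. With the layers `T k` of `u` between
the levels `s 2^k` and `s 2^(k+1)`, the Faber–Krahn inequality for `T k` bounds
`α (k + 1)` by `α k ^ (2 / n)` times the energy of `T k`, where `α k = (s 2^k)^q m(u > s 2^k)`; the
energies of the layers add up to at most that of `u`, and the `α k` to about `‖u‖_q^q`. -/
lemma sobolev_of_faberKrahn_of_nonneg (hm : ∀ x, 0 < m x) (hb : ∀ x y, 0 ≤ b x y)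
    {κ A n : ℝ} (hκ : 0 ≤ κ) (hA : 0 ≤ A) (hn : 2 < n) {B : Set ι}
    (hFK : ∀ f : ι → ℝ, Function.support f ⊆ B → ∑ x, m x * f x ^ 2 ≤
      A * (∑ x, if f x = 0 then 0 else m x) ^ (2 / n) *
        (∑ x, ∑ y, b x y * (f x - f y) ^ 2 + κ * ∑ x, m x * f x ^ 2))
    {u : ι → ℝ} (hu : Function.support u ⊆ B) (hu0 : ∀ x, 0 ≤ u x) :
    (∑ x, m x * u x ^ (2 * n / (n - 2))) ^ ((n - 2) / n) ≤
      4 * 2 ^ (2 * n / (n - 2)) * A *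
        (∑ x, ∑ y, b x y * (u x - u y) ^ 2 + κ * ∑ x, m x * u x ^ 2) := by
  classical
  set q : ℝ := 2 * n / (n - 2) with hq
  have hn0 : 0 < n := by linarith
  have hn2 : 0 < n - 2 := by linarith
  have hq0 : 0 < q := by positivity
  set E : (ι → ℝ) → ℝ := fun f =>
    ∑ x, ∑ y, b x y * (f x - f y) ^ 2 + κ * ∑ x, m x * f x ^ 2 with hE
  have hE0 : ∀ f, 0 ≤ E f := fun f => add_nonneg
    (Finset.sum_nonneg fun x _ => Finset.sum_nonneg fun y _ => mul_nonneg (hb x y) (sq_nonneg _))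
    (mul_nonneg hκ (Finset.sum_nonneg fun x _ => mul_nonneg (hm x).le (sq_nonneg _)))
  change _ ≤ 4 * 2 ^ q * A * E u
  by_cases hzero : ∀ x, u x = 0
  · have : ∑ x, m x * u x ^ q = 0 :=
      Finset.sum_eq_zero fun x _ => by rw [hzero x, Real.zero_rpow hq0.ne', mul_zero]
    rw [this, Real.zero_rpow (by positivity)]
    have := hE0 u
    positivity
  push Not at hzero
  obtain ⟨x₀, hx₀⟩ := hzero
  -- `s` lies below half of every positive value of `u`
  obtain ⟨s, hs0, hs⟩ : ∃ s : ℝ, 0 < s ∧ ∀ x, u x ≠ 0 → 2 * s < u x := by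
    have hne : (Finset.univ.filter fun x => u x ≠ 0).Nonempty := ⟨x₀, by simp [hx₀]⟩
    obtain ⟨z, hz, hzmin⟩ := Finset.exists_min_image _ u hne
    have hzpos : 0 < u z := lt_of_le_of_ne (hu0 z) (Ne.symm (Finset.mem_filter.1 hz).2)
    refine ⟨u z / 4, by positivity, fun x hx => ?_⟩
    have := hzmin x (by simp [hx])
    linarith
  obtain ⟨L, hL⟩ : ∃ L : ℕ, ∀ x, u x ≤ s * 2 ^ L := by
    obtain ⟨z, -, hz⟩ := Finset.exists_max_image Finset.univ u ⟨x₀, Finset.mem_univ _⟩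
    obtain ⟨L, hL⟩ := pow_unbounded_of_one_lt (u z / s) (one_lt_two (α := ℝ))
    refine ⟨L, fun x => (hz x (Finset.mem_univ x)).trans ?_⟩
    rw [div_lt_iff₀ hs0] at hL
    linarith
  set l : ℕ → ℝ := fun k => s * 2 ^ k with hl
  have hl0 : ∀ k, 0 < l k := fun k => by positivity
  have hlmono : Monotone l := fun i j hij =>
    mul_le_mul_of_nonneg_left (pow_le_pow_right₀ one_le_two hij) hs0.le
  have hlsucc : ∀ k, l (k + 1) = 2 * l k := fun k => by simp only [hl]; ring
  set T : ℕ → ι → ℝ := fun k x => min (u x) (l (k + 1)) - min (u x) (l k) with hT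
  set μ : ℕ → ℝ := fun k => ∑ x, if l k < u x then m x else 0 with hμ
  have hμ0 : ∀ k, 0 ≤ μ k := fun k => Finset.sum_nonneg fun x _ => by
    split_ifs; exacts [(hm x).le, le_rfl]
  set α : ℕ → ℝ := fun k => l k ^ q * μ k with hα
  have hα0 : ∀ k, 0 ≤ α k := fun k => mul_nonneg (Real.rpow_nonneg (hl0 k).le _) (hμ0 k)
  have hTE : ∑ k ∈ Finset.range L, E (T k) ≤ E u := by
    simp only [hE, Finset.sum_add_distrib]
    rw [← Finset.mul_sum, Finset.sum_comm, Finset.sum_comm (s := Finset.range L)]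
    refine add_le_add (Finset.sum_le_sum fun x _ => ?_)
      (mul_le_mul_of_nonneg_left (Finset.sum_le_sum fun x _ => ?_) hκ)
    · rw [Finset.sum_comm]
      refine Finset.sum_le_sum fun y _ => ?_
      rw [← Finset.mul_sum]
      exact mul_le_mul_of_nonneg_left (sum_layer_sub_sq_le hlmono L (u x) (u y)) (hb x y)
    · rw [← Finset.mul_sum]
      have := sum_layer_sub_sq_le hlmono L (u x) 0
      simp only [min_eq_left (hl0 _).le, sub_zero] at this
      exact mul_le_mul_of_nonneg_left this (hm x).le
  have hTz : ∀ k x, T k x = 0 ↔ ¬ l k < u x := by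
    intro k x
    have h1 := hlsucc k
    have h2 := hl0 k
    simp only [hT, not_lt]
    constructor
    · intro h
      by_contra! hlt
      rw [min_eq_right hlt.le] at h
      have : l k < min (u x) (l (k + 1)) := lt_min hlt (by linarith)
      linarith
    · intro h
      rw [min_eq_left h, min_eq_left (by linarith), sub_self]
  have hstep : ∀ k, α (k + 1) ≤ 2 ^ q * A * α k ^ (2 / n) * E (T k) := by
    intro k
    have hfk := hFK (T k) (fun x hx => hu (by
      rw [Function.mem_support] at hx ⊢
      have := not_not.1 (mt (hTz k x).2 hx)
      exact ((hl0 k).trans this).ne'))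
    have hsum : (∑ x, if T k x = 0 then 0 else m x) = μ k :=
      Finset.sum_congr rfl fun x _ => by simp only [hTz, ite_not]
    rw [hsum] at hfk
    have hlow : l k ^ 2 * μ (k + 1) ≤ ∑ x, m x * T k x ^ 2 := by
      rw [hμ, Finset.mul_sum]
      refine Finset.sum_le_sum fun x _ => ?_
      split_ifs with h
      · have h1 : T k x = l k := by
          simp only [hT]
          rw [min_eq_right h.le, min_eq_right (by linarith [hlsucc k, hl0 k]), hlsucc]; ring
        rw [h1]; linarith
      · rw [mul_zero]; exact mul_nonneg (hm x).le (sq_nonneg _)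
    have h1 : l k ^ 2 * μ (k + 1) ≤ A * μ k ^ (2 / n) * E (T k) := hlow.trans hfk
    -- the scaling exponents match: `q = 2 + q * (2 / n)`
    have hqq : q = 2 + q * (2 / n) := by rw [hq]; field_simp; ring
    have h2 : l (k + 1) ^ q = 2 ^ q * (l k ^ (q * (2 / n)) * l k ^ 2) := by
      rw [hlsucc, Real.mul_rpow two_pos.le (hl0 k).le]
      congr 1
      nth_rewrite 1 [hqq]
      rw [Real.rpow_add (hl0 k), mul_comm]
      norm_num
    have h3 : α k ^ (2 / n) = l k ^ (q * (2 / n)) * μ k ^ (2 / n) := by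
      rw [hα, Real.mul_rpow (Real.rpow_nonneg (hl0 k).le _) (hμ0 k), Real.rpow_mul (hl0 k).le]
    have h4 : 0 ≤ (2 : ℝ) ^ q * l k ^ (q * (2 / n)) :=
      mul_nonneg (by positivity) (Real.rpow_nonneg (hl0 k).le _)
    calc α (k + 1) = 2 ^ q * l k ^ (q * (2 / n)) * (l k ^ 2 * μ (k + 1)) := by
          simp only [hα]; rw [h2]; ring
      _ ≤ 2 ^ q * l k ^ (q * (2 / n)) * (A * μ k ^ (2 / n) * E (T k)) :=
          mul_le_mul_of_nonneg_left h1 h4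
      _ = 2 ^ q * A * α k ^ (2 / n) * E (T k) := by rw [h3]; ring
  set M : ℝ := ∑ k ∈ Finset.range L, α (k + 1) with hM
  have hpt : ∀ x, u x ≠ 0 → ∃ k ∈ Finset.range L, l (k + 1) < u x ∧ u x ≤ 2 * l (k + 1) := by
    intro x hx
    have hex : ∃ j, u x ≤ l j := ⟨L, hL x⟩
    set j := Nat.find hex with hj
    have hj1 : u x ≤ l j := Nat.find_spec hex
    have hjL : j ≤ L := Nat.find_le (hL x)
    have h2 : ¬ j ≤ 1 := by
      intro h
      have := (hj1.trans (hlmono h))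
      have h3 := hs x hx
      simp only [hl, pow_one] at this
      linarith
    obtain ⟨k, hk⟩ : ∃ k, j = k + 2 := ⟨j - 2, by omega⟩
    refine ⟨k, Finset.mem_range.2 (by omega), ?_, ?_⟩
    · exact not_le.1 (Nat.find_min hex (by omega))
    · rw [← hlsucc]; rw [hk] at hj1; exact hj1
  have hα_le : ∀ k ∈ Finset.range L, α k ≤ M := by
    intro k hk
    have hk' := Finset.mem_range.1 hk
    have h0 : ∀ j ∈ Finset.range L, α (j + 1) ≤ M := fun j hj =>
      Finset.single_le_sum (f := fun j => α (j + 1)) (fun i _ => hα0 _) hj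
    cases k with
    | zero =>
      refine le_trans ?_ (h0 0 hk)
      have h1 : μ 0 ≤ μ (0 + 1) := by
        refine Finset.sum_le_sum fun x _ => ?_
        by_cases hx : l 0 < u x
        · have h3 : l (0 + 1) < u x := by
            have := hs x ((hl0 0).trans hx).ne'
            simpa [hl, mul_comm] using this
          rw [if_pos hx, if_pos h3]
        · rw [if_neg hx]; split_ifs; exacts [(hm x).le, le_rfl]
      exact mul_le_mul (Real.rpow_le_rpow (hl0 0).le (hlmono (Nat.zero_le _)) hq0.le) h1 (hμ0 0)
        (Real.rpow_nonneg (hl0 _).le _)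
    | succ j => exact h0 j (Finset.mem_range.2 (by omega))
  have hM0 : 0 < M := by
    obtain ⟨k, hk, hk1, -⟩ := hpt x₀ hx₀
    refine lt_of_lt_of_le ?_ (Finset.single_le_sum (f := fun j => α (j + 1))
      (fun i _ => hα0 _) hk)
    refine mul_pos (Real.rpow_pos_of_pos (hl0 _) _) (lt_of_lt_of_le (hm x₀) ?_)
    have := Finset.single_le_sum (f := fun x => if l (k + 1) < u x then m x else 0)
      (fun y _ => by split_ifs; exacts [(hm y).le, le_rfl]) (Finset.mem_univ x₀)
    simpa [hk1] using this
  have hMle : M ≤ 2 ^ q * A * M ^ (2 / n) * E u := by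
    calc M ≤ ∑ k ∈ Finset.range L, 2 ^ q * A * M ^ (2 / n) * E (T k) := by
          refine Finset.sum_le_sum fun k hk => (hstep k).trans ?_
          refine mul_le_mul_of_nonneg_right (mul_le_mul_of_nonneg_left ?_ (by positivity)) (hE0 _)
          exact Real.rpow_le_rpow (hα0 k) (hα_le k hk) (by positivity)
      _ = 2 ^ q * A * M ^ (2 / n) * ∑ k ∈ Finset.range L, E (T k) := by rw [Finset.mul_sum]
      _ ≤ _ := mul_le_mul_of_nonneg_left hTE (by positivity)
  have hMpow : M ^ ((n - 2) / n) ≤ 2 ^ q * A * E u := by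
    have h1 : M ^ ((n - 2) / n) = M / M ^ (2 / n) := by
      rw [show (n - 2) / n = 1 - 2 / n by field_simp, Real.rpow_sub hM0, Real.rpow_one]
    rw [h1, div_le_iff₀ (by positivity)]
    linarith
  have hsumle : ∑ x, m x * u x ^ q ≤ 2 ^ q * M := by
    have hswap : 2 ^ q * M = ∑ x, ∑ k ∈ Finset.range L,
        2 ^ q * (l (k + 1) ^ q * if l (k + 1) < u x then m x else 0) := by
      rw [Finset.sum_comm, hM, Finset.mul_sum]
      refine Finset.sum_congr rfl fun k _ => ?_
      rw [← Finset.mul_sum, ← Finset.mul_sum]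
    rw [hswap]
    refine Finset.sum_le_sum fun x _ => ?_
    have hnn : ∀ k ∈ Finset.range L,
        0 ≤ 2 ^ q * (l (k + 1) ^ q * if l (k + 1) < u x then m x else 0) := fun k _ =>
      mul_nonneg (by positivity) (mul_nonneg (Real.rpow_nonneg (hl0 _).le _)
        (by split_ifs; exacts [(hm x).le, le_rfl]))
    by_cases hx : u x = 0
    · rw [hx, Real.zero_rpow hq0.ne', mul_zero]
      rw [hx] at hnn
      exact Finset.sum_nonneg hnn
    · obtain ⟨k, hk, hk1, hk2⟩ := hpt x hx
      refine le_trans ?_ (Finset.single_le_sum hnn hk)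
      rw [if_pos hk1, ← mul_assoc, ← Real.mul_rpow two_pos.le (hl0 _).le, mul_comm]
      exact mul_le_mul_of_nonneg_right (Real.rpow_le_rpow (hu0 x) hk2 hq0.le) (hm x).le
  have hpow4 : ((2 : ℝ) ^ q) ^ ((n - 2) / n) = 4 := by
    rw [← Real.rpow_mul two_pos.le, hq, show 2 * n / (n - 2) * ((n - 2) / n) = 2 by field_simp]
    norm_num
  calc (∑ x, m x * u x ^ q) ^ ((n - 2) / n) ≤ (2 ^ q * M) ^ ((n - 2) / n) :=
        Real.rpow_le_rpow (Finset.sum_nonneg fun x _ =>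
          mul_nonneg (hm x).le (Real.rpow_nonneg (hu0 x) _)) hsumle (by positivity)
    _ = 4 * M ^ ((n - 2) / n) := by
        rw [Real.mul_rpow (by positivity) hM0.le, hpow4]
    _ ≤ 4 * (2 ^ q * A * E u) := by linarith
    _ = _ := by ring

lemma sobolev_of_faberKrahn (hm : ∀ x, 0 < m x) (hb : ∀ x y, 0 ≤ b x y)
    {κ A n : ℝ} (hκ : 0 ≤ κ) (hA : 0 ≤ A) (hn : 2 < n) {B : Set ι}
    (hFK : ∀ f : ι → ℝ, Function.support f ⊆ B → ∑ x, m x * f x ^ 2 ≤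
      A * (∑ x, if f x = 0 then 0 else m x) ^ (2 / n) *
        (∑ x, ∑ y, b x y * (f x - f y) ^ 2 + κ * ∑ x, m x * f x ^ 2))
    {u : ι → ℝ} (hu : Function.support u ⊆ B) :
    (∑ x, m x * |u x| ^ (2 * n / (n - 2))) ^ ((n - 2) / n) ≤
      4 * 2 ^ (2 * n / (n - 2)) * A *
        (∑ x, ∑ y, b x y * (u x - u y) ^ 2 + κ * ∑ x, m x * u x ^ 2) := by
  refine (sobolev_of_faberKrahn_of_nonneg hm hb hκ hA hn hFK (u := fun x => |u x|)
    (fun x hx => hu (by simpa using hx)) (fun x => abs_nonneg _)).trans ?_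
  simp only [sq_abs]
  refine mul_le_mul_of_nonneg_left (add_le_add (Finset.sum_le_sum fun x _ =>
    Finset.sum_le_sum fun y _ => mul_le_mul_of_nonneg_left ?_ (hb x y)) le_rfl) (by positivity)
  exact sq_le_sq.2 (abs_abs_sub_abs_le _ _)

end FaberKrahn

/-! ### Diagonal heat kernel bounds imply a Faber–Krahn inequality -/

section HeatKernelToFaberKrahn

variable {ι : Type*} [Fintype ι] {m c : ι → ℝ} {b : ι → ι → ℝ}

lemma normSq_flow_le [DecidableEq ι] (hm : ∀ x, 0 < m x) (P : (ι → ℝ) →L[ℝ] (ι → ℝ)) {B : Set ι}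
    {K : ℝ}
    (hK : ∀ y ∈ B, ∑ x, m x * (P (Pi.single y (1 / m y)) x * P (Pi.single y (1 / m y)) x) ≤ K)
    {f : ι → ℝ} (hf : Function.support f ⊆ B) :
    ∑ x, m x * (P f x * P f x) ≤ K * (∑ x, m x * |f x|) ^ 2 := by
  set g : ι → ι → ℝ := fun y => P (Pi.single y (1 / m y)) with hg
  set a : ι → ℝ := fun y => m y * f y with ha
  have hfa : f = ∑ y, a y • Pi.single y (1 / m y) := by
    funext x
    rw [Finset.sum_apply, Finset.sum_eq_single x]
    · have := (hm x).ne'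
      simp only [ha, Pi.smul_apply, Pi.single_eq_same, smul_eq_mul]; field_simp
    · intro y _ hy; simp [Pi.single_eq_of_ne hy.symm]
    · simp
  have hPf : ∀ x, P f x = ∑ y, a y * g y x := by
    intro x
    nth_rewrite 1 [hfa]
    rw [map_sum, Finset.sum_apply]
    simp [hg]
  have habs : ∑ x, m x * |f x| = ∑ y, |a y| :=
    Finset.sum_congr rfl fun y _ => by rw [ha, abs_mul, abs_of_pos (hm y)]
  have hpt : ∀ x, P f x * P f x ≤ (∑ y, |a y|) * ∑ y, |a y| * (g y x * g y x) := by
    intro x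
    rw [hPf, ← sq]
    refine Finset.sum_sq_le_sum_mul_sum_of_sq_le_mul _ (fun y _ => abs_nonneg _)
      (fun y _ => mul_nonneg (abs_nonneg _) (mul_self_nonneg _)) fun y _ => le_of_eq ?_
    rw [← mul_assoc, abs_mul_abs_self]; ring
  calc ∑ x, m x * (P f x * P f x)
      ≤ ∑ x, m x * ((∑ y, |a y|) * ∑ y, |a y| * (g y x * g y x)) :=
        Finset.sum_le_sum fun x _ => mul_le_mul_of_nonneg_left (hpt x) (hm x).le
    _ = (∑ y, |a y|) * ∑ y, |a y| * ∑ x, m x * (g y x * g y x) := by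
        simp only [Finset.mul_sum]
        rw [Finset.sum_comm]
        refine (Finset.sum_congr rfl fun y _ => ?_)
        exact Finset.sum_congr rfl fun x _ => by ring
    _ ≤ (∑ y, |a y|) * ∑ y, |a y| * K := by
        refine mul_le_mul_of_nonneg_left (Finset.sum_le_sum fun y _ => ?_)
          (Finset.sum_nonneg fun y _ => abs_nonneg _)
        by_cases hy : y ∈ B
        · exact mul_le_mul_of_nonneg_left (hK y hy) (abs_nonneg _)
        · have : a y = 0 := by
            simp only [ha]; rw [Function.notMem_support.1 (fun h => hy (hf h)), mul_zero]
          simp [this]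
    _ = K * (∑ x, m x * |f x|) ^ 2 := by rw [← Finset.sum_mul, habs]; ring

/-- Nash's inequality at the time `t` at which the `ℓ¹` term is at most half of the squared `ℓ²`
norm, by the Cauchy–Schwarz inequality on the support of `f`, gives the Faber–Krahn inequality; if
this `t` exceeds `r² / 2`, the zeroth order term `‖f‖² / r²` alone suffices. -/
lemma faberKrahn_of_heatKernel_bound [DecidableEq ι] (hm : ∀ x, 0 < m x)
    (hb : ∀ x y, b x y = b y x) (hb0 : ∀ x y, 0 ≤ b x y) {B : Set ι}
    (hc : ∀ x ∈ B, c x = ∑ y, b x y) {P : ℝ → (ι → ℝ) →L[ℝ] (ι → ℝ)} (hP0 : ∀ f, P 0 f = f)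
    (hP : ∀ f t, HasDerivAt (fun s => P s f) (-(killedLaplacian m c b (P t f))) t)
    {n r k : ℝ} (hn : 0 < n) (hr : 0 < r) (hk : 0 < k)
    (hker : ∀ y ∈ B, ∀ t, 0 < t → 2 * t ≤ r ^ 2 →
      ∑ x, m x * (P t (Pi.single y (1 / m y)) x * P t (Pi.single y (1 / m y)) x) ≤
        k * (r ^ 2 / (2 * t)) ^ (n / 2))
    {f : ι → ℝ} (hf : Function.support f ⊆ B) :
    ∑ x, m x * f x ^ 2 ≤ r ^ 2 * (2 * k) ^ (2 / n) *
      (∑ x, if f x = 0 then 0 else m x) ^ (2 / n) *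
        (∑ x, ∑ y, b x y * (f x - f y) ^ 2 + 1 / r ^ 2 * ∑ x, m x * f x ^ 2) := by
  set E := ∑ x, ∑ y, b x y * (f x - f y) ^ 2 with hE
  set μ := ∑ x, if f x = 0 then 0 else m x with hμ
  set N := ∑ x, m x * f x ^ 2 with hN
  have hE0 : 0 ≤ E := Finset.sum_nonneg fun x _ =>
    Finset.sum_nonneg fun y _ => mul_nonneg (hb0 x y) (sq_nonneg _)
  have hN0 : 0 ≤ N := Finset.sum_nonneg fun x _ => mul_nonneg (hm x).le (sq_nonneg _)
  by_cases hzero : ∀ x, f x = 0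
  · have : N = 0 := Finset.sum_eq_zero fun x _ => by rw [hzero x]; ring
    have hμ0 : 0 ≤ μ := Finset.sum_nonneg fun x _ => by split_ifs; exacts [le_rfl, (hm x).le]
    rw [this]; positivity
  push Not at hzero
  obtain ⟨x₀, hx₀⟩ := hzero
  have hμ0 : 0 < μ := by
    have := Finset.single_le_sum (f := fun x => if f x = 0 then 0 else m x)
      (fun y _ => by split_ifs; exacts [le_rfl, (hm y).le]) (Finset.mem_univ x₀)
    simp only [hx₀, if_false] at this
    exact (hm x₀).trans_le this
  set T := r ^ 2 * (2 * k) ^ (2 / n) * μ ^ (2 / n) with hT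
  have hT0 : 0 < T := by positivity
  rcases lt_or_ge (r ^ 2) T with hlt | hle
  · have h1 : N ≤ T * (1 / r ^ 2 * N) := by
      rw [← mul_assoc, mul_one_div]
      exact le_mul_of_one_le_left hN0 ((one_le_div (by positivity)).2 hlt.le)
    nlinarith [mul_nonneg hT0.le hE0]
  · have hKval : k * (r ^ 2 / (2 * (T / 2))) ^ (n / 2) = 1 / (2 * μ) := by
      have h1 : r ^ 2 / (2 * (T / 2)) = ((2 * k * μ) ^ (2 / n))⁻¹ := by
        rw [hT, mul_assoc, ← Real.mul_rpow (by positivity) hμ0.le]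
        have : (2 * k * μ) ^ (2 / n) ≠ 0 := by positivity
        field_simp
      rw [h1, Real.inv_rpow (by positivity), ← Real.rpow_mul (by positivity),
        show 2 / n * (n / 2) = 1 by field_simp, Real.rpow_one]
      field_simp
    have hnash := heatFlow_normSq_sub_le hm hb (v := fun s => P s f) (hP f)
      (t := T / 2) (by positivity)
    simp only [hP0] at hnash
    have h1 : ∑ x, m x * (f x * f x) = N :=
      Finset.sum_congr rfl fun x _ => by rw [sq]
    have h2 : ∑ x, m x * (killedLaplacian m c b f x * f x) = 2⁻¹ * E := by
      rw [sum_killedLaplacian_self hm hb, add_eq_left]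
      refine Finset.sum_eq_zero fun x _ => ?_
      by_cases hx : x ∈ B
      · rw [hc x hx, sub_self, zero_mul]
      · rw [Function.notMem_support.1 (fun h => hx (hf h))]; ring
    have h3 := normSq_flow_le hm (P (T / 2)) (fun y hy => hker y hy (T / 2) (by positivity)
      (by linarith)) hf
    rw [hKval] at h3
    have h4 : (∑ x, m x * |f x|) ^ 2 ≤ μ * N := by
      refine Finset.sum_sq_le_sum_mul_sum_of_sq_le_mul _
        (fun x _ => by split_ifs; exacts [le_rfl, (hm x).le])
        (fun x _ => mul_nonneg (hm x).le (sq_nonneg _)) fun x _ => ?_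
      by_cases hx : f x = 0
      · simp [hx]
      · rw [if_neg hx, mul_pow, sq_abs]; exact le_of_eq (by ring)
    have h5 : 1 / (2 * μ) * (∑ x, m x * |f x|) ^ 2 ≤ N / 2 := by
      calc _ ≤ 1 / (2 * μ) * (μ * N) := mul_le_mul_of_nonneg_left h4 (by positivity)
        _ = N / 2 := by field_simp
    rw [h1, h2] at hnash
    have h6 : N ≤ T * E := by linarith
    have h7 : 0 ≤ T * (1 / r ^ 2 * N) := by positivity
    linarith

/-- Domination of the heat kernel of a finite set: its diagonal at time `2t`, which is the squared
norm of the kernel at time `t`, is bounded by every supersolution with initial value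
`δ_y / m(y)`. -/
lemma normSq_flow_single_le [DecidableEq ι] (hm : ∀ x, 0 < m x)
    (hb : ∀ x y, b x y = b y x) (hb0 : ∀ x y, 0 ≤ b x y) (hc : ∀ x, ∑ y, b x y ≤ c x)
    {P : ℝ → (ι → ℝ) →L[ℝ] (ι → ℝ)} (hP0 : ∀ f, P 0 f = f)
    (hP : ∀ f t, HasDerivAt (fun s => P s f) (-(killedLaplacian m c b (P t f))) t)
    (y : ι) {u u' : ℝ → ι → ℝ}
    (hu : ∀ t, 0 ≤ t → ∀ x, HasDerivWithinAt (fun s => u s x) (u' t x) (Set.Ici 0) t)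
    (hsuper : ∀ t, 0 ≤ t → ∀ x, -(killedLaplacian m c b (u t) x) ≤ u' t x)
    (h0 : ∀ x, u 0 x = (Pi.single y (1 / m y) : ι → ℝ) x) {t : ℝ} (ht : 0 ≤ t) :
    ∑ x, m x * (P t (Pi.single y (1 / m y)) x * P t (Pi.single y (1 / m y)) x) ≤
      u (2 * t) y := by
  set δ : ι → ℝ := Pi.single y (1 / m y) with hδ
  rw [← heatFlow_pairing_eq hm hb (v := fun s => P s δ) (w := fun s => P s δ) (hP δ) (hP δ)]
  simp only [hP0]
  have h1 : ∑ x, m x * (P (2 * t) δ x * δ x) = P (2 * t) δ y := by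
    rw [Finset.sum_eq_single y]
    · have := (hm y).ne'
      rw [hδ, Pi.single_eq_same]; field_simp
    · intro x _ hx; rw [hδ, Pi.single_eq_of_ne hx]; ring
    · simp
  rw [h1]
  have h2 := killedLaplacian_minimum_principle hm hb hb0 hc
    (w := fun s x => u s x - P s δ x) (w' := fun s x => u' s x + killedLaplacian m c b (P s δ) x)
    (fun s hs x => by
      have := (hasDerivAt_pi.1 (hP δ s) x).hasDerivWithinAt (s := Set.Ici 0)
      simpa using (hu s hs x).fun_sub this)
    (fun s hs x => by
      have h3 := hsuper s hs x
      have h4 : killedLaplacian m c b (fun x => u s x - P s δ x) =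
          killedLaplacian m c b (u s) - killedLaplacian m c b (P s δ) :=
        map_sub (killedLaplacian m c b) (u s) (P s δ)
      rw [h4, Pi.sub_apply]
      linarith)
    (fun x => by simp only [hP0, h0, hδ, sub_self, le_refl])
    (t := 2 * t) (by linarith) y
  exact sub_nonneg.1 h2

lemma normSq_flow_single_le_inv [DecidableEq ι] (hm : ∀ x, 0 < m x)
    (hb : ∀ x y, b x y = b y x) (hb0 : ∀ x y, 0 ≤ b x y) (hc : ∀ x, ∑ y, b x y ≤ c x)
    {P : ℝ → (ι → ℝ) →L[ℝ] (ι → ℝ)} (hP0 : ∀ f, P 0 f = f)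
    (hP : ∀ f t, HasDerivAt (fun s => P s f) (-(killedLaplacian m c b (P t f))) t)
    (y : ι) {t : ℝ} (ht : 0 ≤ t) :
    ∑ x, m x * (P t (Pi.single y (1 / m y)) x * P t (Pi.single y (1 / m y)) x) ≤ 1 / m y := by
  refine (heatFlow_normSq_antitone hm hb hb0 hc (hP (Pi.single y (1 / m y))) ht).trans
    (le_of_eq ?_)
  simp only [hP0]
  rw [Finset.sum_eq_single y]
  · have := (hm y).ne'
    rw [Pi.single_eq_same]; field_simp
  · intro x _ hx; rw [Pi.single_eq_of_ne hx]; ring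
  · simp

end HeatKernelToFaberKrahn

/-! ### Volumes, norms and heat kernels of locally finite weighted graphs -/

namespace WeightedGraph

variable {X : Type*} (G : WeightedGraph X)

lemma vol_eq_sum {A : Set X} (hA : A.Finite) : G.vol A = ∑ x ∈ hA.toFinset, G.m x := by
  have h : (hA.toFinset : Set X) = A := hA.coe_toFinset
  rw [← Finset.tsum_subtype', vol, h]

lemma vol_mono {A A' : Set X} (hA' : A'.Finite) (h : A ⊆ A') : G.vol A ≤ G.vol A' := by
  rw [G.vol_eq_sum hA', G.vol_eq_sum (hA'.subset h)]
  exact Finset.sum_le_sum_of_subset_of_nonneg (by simpa using h) fun x _ _ => (G.m_pos x).le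

lemma vol_pos {A : Set X} (hA : A.Finite) (h : A.Nonempty) : 0 < G.vol A := by
  rw [G.vol_eq_sum hA]
  exact Finset.sum_pos (fun x _ => G.m_pos x) (by simpa using h)

variable {G}

lemma lpNorm_sq {q : ℝ} (hq : 0 < q) {f : X → ℝ} {F : Finset X} (hf : ∀ x, x ∉ F → f x = 0) :
    G.lpNorm q f ^ 2 = (∑ x : F, G.m x * |f x| ^ q) ^ (2 / q) := by
  have h1 : ∑' x, G.m x * |f x| ^ q = ∑ x : F, G.m x * |f x| ^ q := by
    rw [tsum_eq_sum (s := F) fun x hx => by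
      rw [hf x hx, abs_zero, Real.zero_rpow hq.ne', mul_zero]]
    exact (Finset.sum_coe_sort F fun x => G.m x * |f x| ^ q).symm
  have h2 : 0 ≤ ∑ x : F, G.m x * |f x| ^ q := Finset.sum_nonneg fun x _ =>
    mul_nonneg (G.m_pos x).le (Real.rpow_nonneg (abs_nonneg _) _)
  rw [lpNorm, h1, ← Real.rpow_natCast, ← Real.rpow_mul h2]
  congr 1
  push_cast
  ring

lemma lpNorm_two_sq {f : X → ℝ} {F : Finset X} (hf : ∀ x, x ∉ F → f x = 0) :
    G.lpNorm 2 f ^ 2 = ∑ x : F, G.m x * f x ^ 2 := by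
  rw [lpNorm_sq two_pos hf, div_self two_ne_zero, Real.rpow_one]
  exact Finset.sum_congr rfl fun x _ => by rw [Real.rpow_two, sq_abs]

lemma summable_mul_of_finite_neighbors {x : X} (hx : {y | 0 < G.b x y}.Finite) (g : X → ℝ) :
    Summable fun y => G.b x y * g y := by
  refine summable_of_hasFiniteSupport (hx.subset fun y hy => ?_)
  exact lt_of_le_of_ne (G.b_nonneg x y) fun h => hy (by simp [← h])

/-- If `F` contains the support of `u` together with all its neighbours, then the energy of `u`
on `F` is at most `‖|∇u|‖₂²`. -/
lemma sum_energy_le_lpNorm_gradNorm (hloc : ∀ x, {y | 0 < G.b x y}.Finite) {u : X → ℝ}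
    {F : Finset X} (hF : ∀ x, x ∉ F → u x = 0) (hF' : ∀ x y, u x ≠ 0 → 0 < G.b x y → y ∈ F) :
    ∑ x : F, ∑ y : F, G.b x y * (u x - u y) ^ 2 ≤ G.lpNorm 2 (G.gradNorm u) ^ 2 := by
  have hgrad : ∀ x, x ∉ F → G.gradNorm u x = 0 := by
    intro x hx
    have h1 : ∀ y, G.b x y * (u x - u y) ^ 2 = 0 := by
      intro y
      rcases (G.b_nonneg x y).eq_or_lt with h | h
      · rw [← h, zero_mul]
      · have : u y = 0 := by
          by_contra hy
          exact hx (hF' y x hy (by rwa [G.b_symm]))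
        rw [hF x hx, this]; ring
    simp [gradNorm, h1]
  rw [lpNorm_two_sq hgrad]
  refine Finset.sum_le_sum fun x _ => ?_
  have hs := summable_mul_of_finite_neighbors (hloc x) fun y => (u x - u y) ^ 2
  have hnn : ∀ y, 0 ≤ G.b x y * (u x - u y) ^ 2 := fun y =>
    mul_nonneg (G.b_nonneg _ _) (sq_nonneg _)
  have hm := (G.m_pos x)
  rw [gradNorm, Real.sq_sqrt (mul_nonneg (by positivity) (tsum_nonneg hnn)), ← mul_assoc,
    mul_one_div, div_self hm.ne', one_mul]
  rw [Finset.sum_coe_sort F fun y => G.b x y * (u x - u y) ^ 2]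
  exact hs.sum_le_tsum F fun y _ => hnn y

/-- On a finite set, the Laplacian of a nonnegative function is at most the Dirichlet Laplacian
of its restriction. -/
lemma laplacian_le_killedLaplacian (hloc : ∀ x, {y | 0 < G.b x y}.Finite) {F : Finset X}
    {u : X → ℝ} (hu : ∀ x, 0 ≤ u x) (x : F) :
    G.laplacian u x ≤ killedLaplacian (fun x : F => G.m x) (fun x : F => ∑' y, G.b x y)
      (fun x y : F => G.b x y) (fun x => u x) x := by
  rw [killedLaplacian_apply, laplacian, one_div_mul_eq_div]
  have h1 : ∑' y, G.b x y * (u x - u y) = (∑' y, G.b x y) * u x - ∑' y, G.b x y * u y := by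
    simp only [mul_sub]
    rw [((G.b_summable x).mul_right (u x)).tsum_sub
      (summable_mul_of_finite_neighbors (hloc x) u), tsum_mul_right]
  rw [h1]
  refine div_le_div_of_nonneg_right (sub_le_sub_left ?_ _) (G.m_pos x).le
  rw [Finset.sum_coe_sort F fun y => G.b x y * u y]
  exact (summable_mul_of_finite_neighbors (hloc x) u).sum_le_tsum F fun y _ =>
    mul_nonneg (G.b_nonneg _ _) (hu y)

/-- Diagonal upper bounds of the heat kernel on a finite set `B` up to time `r²`, or alternatively
bounds of `1 / m`, yield a Sobolev inequality for functions supported in `B`. -/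
theorem sobolev_of_heatKernel_bound (hloc : ∀ x, {y | 0 < G.b x y}.Finite) {B : Set X}
    (hB : B.Finite) {n r k : ℝ} (hn : 2 < n) (hr : 0 < r) (hk : 0 < k)
    (hker : ∀ y ∈ B, ∀ t, 0 < t → t ≤ r ^ 2 →
      1 / G.m y ≤ k * (r ^ 2 / t) ^ (n / 2) ∨
      G.heatKernel t y y ≤ ENNReal.ofReal (k * (r ^ 2 / t) ^ (n / 2)))
    {u : X → ℝ} (hu : Function.support u ⊆ B) :
    G.lpNorm (2 * n / (n - 2)) u ^ 2 ≤
      4 * 2 ^ (2 * n / (n - 2)) * (r ^ 2 * (2 * k) ^ (2 / n)) *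
        (G.lpNorm 2 (G.gradNorm u) ^ 2 + 1 / r ^ 2 * G.lpNorm 2 u ^ 2) := by
  classical
  have hn0 : 0 < n := by linarith
  have hn2 : 0 < n - 2 := by linarith
  -- the Dirichlet problem is posed on `B` together with its neighbours, so that there is no
  -- killing on `B` itself
  have hfin : (B ∪ ⋃ x ∈ B, {y | 0 < G.b x y}).Finite :=
    hB.union (hB.biUnion fun x _ => hloc x)
  set F : Finset X := hfin.toFinset with hF
  have hBF : ∀ x ∈ B, x ∈ F := fun x hx => by
    rw [hF, Set.Finite.mem_toFinset]; exact Or.inl hx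
  have hnb : ∀ x y, x ∈ B → 0 < G.b x y → y ∈ F := fun x y hx hy => by
    rw [hF, Set.Finite.mem_toFinset]; exact Or.inr (Set.mem_biUnion hx hy)
  have huF : ∀ x, x ∉ F → u x = 0 := fun x hx =>
    Function.notMem_support.1 fun h => hx (hBF x (hu h))
  set m : F → ℝ := fun x => G.m x with hm'
  set b : F → F → ℝ := fun x y => G.b x y with hb'
  set c : F → ℝ := fun x => ∑' y, G.b x y with hc'
  have hm : ∀ x, 0 < m x := fun x => G.m_pos x
  have hbs : ∀ x y, b x y = b y x := fun x y => G.b_symm x y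
  have hb0 : ∀ x y, 0 ≤ b x y := fun x y => G.b_nonneg x y
  have hc : ∀ x, ∑ y, b x y ≤ c x := fun x => by
    simp only [hb', hc']
    rw [Finset.sum_coe_sort F fun y => G.b x y]
    exact (G.b_summable x).sum_le_tsum F fun y _ => G.b_nonneg x y
  have hcB : ∀ x ∈ {x : F | (x : X) ∈ B}, c x = ∑ y, b x y := fun x hx => by
    simp only [hb', hc']
    rw [Finset.sum_coe_sort F fun y => G.b x y]
    refine tsum_eq_sum fun y hy => ?_
    by_contra h
    exact hy (hnb x y hx (lt_of_le_of_ne (G.b_nonneg x y) (Ne.symm h)))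
  obtain ⟨P, hP0, hP⟩ := exists_linear_flow (killedLaplacian m c b)
  have hkerF : ∀ y ∈ {x : F | (x : X) ∈ B}, ∀ t, 0 < t → 2 * t ≤ r ^ 2 →
      ∑ x, m x * (P t (Pi.single y (1 / m y)) x * P t (Pi.single y (1 / m y)) x) ≤
        k * (r ^ 2 / (2 * t)) ^ (n / 2) := by
    intro y hy t ht htr
    rcases hker y hy (2 * t) (by linarith) htr with h | h
    · exact (normSq_flow_single_le_inv hm hbs hb0 hc hP0 hP y ht.le).trans h
    · refine (ENNReal.ofReal_le_ofReal_iff (by positivity)).1 (le_trans ?_ h)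
      refine le_iInf₂ fun v hv => ENNReal.ofReal_le_ofReal ?_
      refine normSq_flow_single_le hm hbs hb0 hc hP0 hP y (u := fun s x => v s x)
        (u' := fun s x => -(G.laplacian (v s) x)) (fun s hs x => hv.heat s hs x)
        (fun s hs x => neg_le_neg (laplacian_le_killedLaplacian hloc (hv.nonneg s hs) x))
        (fun x => ?_) ht.le
      by_cases hxy : x = y
      · rw [hxy, Pi.single_eq_same]; exact hv.initial_self
      · rw [Pi.single_eq_of_ne hxy]
        exact hv.initial_ne x fun h => hxy (Subtype.ext h)
  have hsob := sobolev_of_faberKrahn (m := m) (b := b) (κ := 1 / r ^ 2)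
    (A := r ^ 2 * (2 * k) ^ (2 / n)) (n := n) (B := {x : F | (x : X) ∈ B}) hm hb0
    (by positivity) (by positivity) hn
    (fun f hf => faberKrahn_of_heatKernel_bound hm hbs hb0 hcB hP0 hP hn0 hr hk hkerF hf)
    (u := fun x => u x) (fun x hx => hu hx)
  rw [lpNorm_sq (by positivity) huF, lpNorm_two_sq huF,
    show 2 / (2 * n / (n - 2)) = (n - 2) / n by field_simp]
  refine hsob.trans (mul_le_mul_of_nonneg_left (add_le_add ?_ le_rfl) (by positivity))
  exact sum_energy_le_lpNorm_gradNorm hloc huF fun x y hx hy => hnb x y (hu hx) hy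

/-! ### Geometry of balls of an intrinsic path metric -/

variable {ρ : X → X → ℝ}

lemma ofReal_le_jumpSize {x y : X} (h : 0 < G.b x y) (r : ℝ) :
    ENNReal.ofReal (ρ x y) ≤ G.jumpSize ρ x r := by
  have hne : y ≠ x := fun e => by rw [e, G.b_self] at h; exact lt_irrefl _ h
  exact le_iSup₂_of_le x y (le_iSup_of_le ⟨h, Or.inr ⟨rfl, hne⟩⟩ le_rfl)

lemma finite_neighbors (hball : ∀ x r, (metricBall ρ x r).Finite) (hjump : G.maxJump ρ < ⊤)
    (x : X) : {y | 0 < G.b x y}.Finite := by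
  refine (hball x (G.maxJump ρ).toReal).subset fun y hy => ?_
  refine (ENNReal.ofReal_le_iff_le_toReal hjump.ne).1 ((ofReal_le_jumpSize hy 0).trans ?_)
  exact le_iSup₂_of_le x 0 (le_iSup_of_le le_rfl le_rfl)

/-- A path leaving a ball around `o` has a first edge that does so, and the path is at least as
long as the distances to and from the end of that edge. -/
lemma exists_crossing_edge (hρ : G.IsIntrinsicMetric ρ) {w : X → X → ℝ≥0∞}
    (hw : ∀ x y, ENNReal.ofReal (ρ x y) =
      ⨅ p : G.toSimpleGraph.Walk x y, (p.darts.map fun e => w e.fst e.snd).sum)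
    (o : X) (s : ℝ) {a x : X} (p : G.toSimpleGraph.Walk a x) (ha : ρ o a ≤ s) (hx : s < ρ o x) :
    ∃ z z', 0 < G.b z z' ∧ ρ o z ≤ s ∧ s < ρ o z' ∧
      ENNReal.ofReal (ρ a z') + ENNReal.ofReal (ρ z' x) ≤
        (p.darts.map fun e => w e.fst e.snd).sum := by
  induction p with
  | nil => exact absurd ha (not_le.2 hx)
  | @cons a c x h p ih =>
    have hac : ENNReal.ofReal (ρ a c) ≤ w a c := by
      rw [hw]
      exact (iInf_le _ h.toWalk).trans (by simp)
    rcases le_or_gt (ρ o c) s with hc | hc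
    · obtain ⟨z, z', hzz', hz, hz', hle⟩ := ih hc hx
      refine ⟨z, z', hzz', hz, hz', ?_⟩
      have h1 : ENNReal.ofReal (ρ a z') ≤ ENNReal.ofReal (ρ a c) + ENNReal.ofReal (ρ c z') := by
        rw [← ENNReal.ofReal_add (hρ.nonneg _ _) (hρ.nonneg _ _)]
        exact ENNReal.ofReal_le_ofReal (hρ.triangle _ _ _)
      simp only [SimpleGraph.Walk.darts_cons, List.map_cons, List.sum_cons]
      calc _ ≤ ENNReal.ofReal (ρ a c) + ENNReal.ofReal (ρ c z') + ENNReal.ofReal (ρ z' x) :=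
            add_le_add h1 le_rfl
        _ = ENNReal.ofReal (ρ a c) + (ENNReal.ofReal (ρ c z') + ENNReal.ofReal (ρ z' x)) :=
            add_assoc _ _ _
        _ ≤ _ := add_le_add hac hle
    · refine ⟨a, c, h, ha, hc, ?_⟩
      simp only [SimpleGraph.Walk.darts_cons, List.map_cons, List.sum_cons]
      refine add_le_add hac ?_
      rw [hw]
      exact iInf_le _ p

/-- If all edges starting in a ball of radius `r` are short compared to `r`, then every point of
the ball is approximately joined to the center by a midpoint. -/
lemma exists_midpoint (hρ : G.IsIntrinsicMetric ρ) (hpath : G.IsPathMetric ρ) {o : X} {r : ℝ}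
    (hr : 0 < r) (hedge : ∀ y z, ρ o y ≤ r → 0 < G.b y z → ρ y z ≤ r / 8) {x : X}
    (hx : ρ o x ≤ r) : ∃ z, ρ o z ≤ r / 2 ∧ ρ z x ≤ 3 * r / 4 := by
  rcases le_or_gt (ρ o x) (r / 2) with h | h
  · exact ⟨x, h, by rw [hρ.self]; positivity⟩
  obtain ⟨w, -, hw⟩ := hpath
  have h1 : ENNReal.ofReal (ρ o x) < ENNReal.ofReal (ρ o x + r / 8) :=
    (ENNReal.ofReal_lt_ofReal_iff (by linarith)).2 (by linarith)
  rw [hw] at h1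
  obtain ⟨p, hp⟩ := iInf_lt_iff.1 h1
  obtain ⟨z, z', hzz', hz, hz', hle⟩ := exists_crossing_edge hρ hw o (r / 2) p
    (by rw [hρ.self]; positivity) h
  have h2 := hle.trans hp.le
  rw [← ENNReal.ofReal_add (hρ.nonneg _ _) (hρ.nonneg _ _),
    ENNReal.ofReal_le_ofReal_iff (by linarith)] at h2
  have h3 := hedge z z' (by linarith) hzz'
  have h4 := hρ.triangle z z' x
  exact ⟨z, hz, by linarith⟩

/-- Balls of radius `r` around points of `B_o(r)` have volume comparable to that of `B_o(r)`, by
doubling around `o` and around an approximate midpoint. Only radii in `[r / 4, r]` enter. -/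
lemma vol_ball_le (hρ : G.IsIntrinsicMetric ρ) (hpath : G.IsPathMetric ρ)
    (hball : ∀ x r, (metricBall ρ x r).Finite) {o : X} {r Q D : ℝ}
    (hr : 0 < r) (hQ : 0 ≤ Q) (hedge : ∀ y z, ρ o y ≤ r → 0 < G.b y z → ρ y z ≤ r / 8)
    (hdoub : ∀ z, ρ o z ≤ r → ∀ σ, r / 4 ≤ σ → σ ≤ r →
      G.vol (metricBall ρ z r) ≤ Q * (r / σ) ^ D * G.vol (metricBall ρ z σ))
    {x : X} (hx : ρ o x ≤ r) :
    G.vol (metricBall ρ o r) ≤ Q ^ 2 * 8 ^ D * G.vol (metricBall ρ x r) := by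
  obtain ⟨z, hz, hzx⟩ := exists_midpoint hρ hpath hr hedge hx
  have h1 := hdoub o (by rw [hρ.self]; exact hr.le) (r / 2) (by linarith) (by linarith)
  have h2 := hdoub z (by linarith) (r / 4) le_rfl (by linarith)
  have h3 : G.vol (metricBall ρ o (r / 2)) ≤ G.vol (metricBall ρ z r) := by
    refine G.vol_mono (hball _ _) fun y (hy : ρ o y ≤ r / 2) => ?_
    have := hρ.triangle z o y
    rw [hρ.symm z o] at this
    exact this.trans (by linarith)
  have h4 : G.vol (metricBall ρ z (r / 4)) ≤ G.vol (metricBall ρ x r) := by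
    refine G.vol_mono (hball _ _) fun y (hy : ρ z y ≤ r / 4) => ?_
    have := hρ.triangle x z y
    rw [hρ.symm x z] at this
    exact this.trans (by linarith)
  rw [show r / (r / 2) = 2 by field_simp] at h1
  rw [show r / (r / 4) = 4 by field_simp] at h2
  calc G.vol (metricBall ρ o r) ≤ Q * 2 ^ D * G.vol (metricBall ρ o (r / 2)) := h1
    _ ≤ Q * 2 ^ D * (Q * 4 ^ D * G.vol (metricBall ρ x r)) :=
        mul_le_mul_of_nonneg_left (h3.trans (h2.trans
          (mul_le_mul_of_nonneg_left h4 (by positivity)))) (by positivity)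
    _ = Q ^ 2 * (2 ^ D * 4 ^ D) * G.vol (metricBall ρ x r) := by ring
    _ = _ := by rw [← Real.mul_rpow (by norm_num) (by norm_num)]; norm_num

/-- On the diagonal and for `t ≤ R₂²`, the Gaussian bound has no exponential factor. -/
lemma GaussianBounds.heatKernel_diag_le {Ψ N : X → ℝ → ℝ} {R₁ R₂ : ℝ} {B : Set X}
    (hG : G.GaussianBounds ρ Ψ N R₁ R₂ B) (hρ : G.IsIntrinsicMetric ρ)
    {t : ℝ} (ht : 0 < t) (hR₂ : 0 ≤ R₂) (h1 : R₁ ^ 2 ≤ t) (h2 : t ≤ R₂ ^ 2) {x : X} (hx : x ∈ B)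
    (hvol : 0 ≤ G.vol (metricBall ρ x (Real.sqrt t))) :
    G.heatKernel t x x ≤
      ENNReal.ofReal (Ψ x (Real.sqrt t) ^ 2 / G.vol (metricBall ρ x (Real.sqrt t))) := by
  have h := hG t ht h1 x hx x hx
  have hs : Real.sqrt t ≤ R₂ := Real.sqrt_le_iff.2 ⟨hR₂, h2⟩
  have hexp : gaussExponent (G.maxJump ρ).toReal 0 t = 0 := by
    simp [gaussExponent, Real.sqrt_sq ht.le]
  simp only [min_eq_left hs, min_eq_left h2, hρ.self, hexp] at h
  refine h.trans (le_of_eq ?_)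
  congr 1
  rw [Real.sqrt_mul_self hvol]
  have h0 : Real.sqrt (t ^ 2 + 0 ^ 2 * (G.maxJump ρ).toReal ^ 2) - t = 0 := by
    simp [Real.sqrt_sq ht.le]
  rw [h0]
  simp only [mul_zero, max_eq_left zero_le_one, Real.one_rpow, sub_self, neg_zero, Real.exp_zero,
    mul_one]
  ring

end WeightedGraph

/-! ### The variable dimension -/

lemma supNorm_lt_top {α : Type*} (f : α → ℝ) {W : Set α} (hW : W.Finite) : supNorm f W < ⊤ := by
  refine lt_of_le_of_lt (b := ∑ a ∈ hW.toFinset, ENNReal.ofReal |f a|) ?_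
    (ENNReal.sum_lt_top.2 fun _ _ => ENNReal.ofReal_lt_top)
  refine iSup₂_le fun a ha => ?_
  exact Finset.single_le_sum (f := fun a => ENNReal.ofReal |f a|) (fun _ _ => zero_le)
    (hW.mem_toFinset.2 ha)

lemma ofReal_le_supNorm {α : Type*} {f : α → ℝ} {W : Set α} {a : α} (ha : a ∈ W) :
    ENNReal.ofReal (f a) ≤ supNorm f W :=
  (ENNReal.ofReal_le_ofReal (le_abs_self _)).trans (le_iSup₂ (f := fun a (_ : a ∈ W) =>
    ENNReal.ofReal |f a|) a ha)

lemma le_toReal_supNorm {α : Type*} {f : α → ℝ} {W : Set α} (hW : supNorm f W ≠ ⊤) {a : α}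
    (ha : a ∈ W) : f a ≤ (supNorm f W).toReal :=
  (ENNReal.ofReal_le_iff_le_toReal hW).1 (ofReal_le_supNorm ha)

/-- The inner radius is admissible as the lower end of the range of radii. -/
lemma innerRadius_spec {R₁ D r : ℝ} (hD : 2 < D) (hr : 0 < r) (hR : 4 * R₁ ≤ r) :
    0 < innerRadius R₁ D r ∧ innerRadius R₁ D r < r ∧ R₁ ≤ innerRadius R₁ D r := by
  unfold innerRadius
  split_ifs with h
  · have h2 : max 4 (4 * R₁) ≤ Real.log r := (Real.le_log_iff_exp_le hr).2 h.1
    have h4 : 4 ≤ Real.log r := (le_max_left _ _).trans h2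
    have h5 : 4 * R₁ ≤ Real.log r := (le_max_right _ _).trans h2
    have hp : 1 ≤ radiusExponent D := by
      have h6 : 0 < 2 / (D + 2) := by apply div_pos <;> linarith
      have h7 : 2 / (D + 2) ≤ 1 := (div_le_one (by linarith)).2 (by linarith)
      have h8 : Real.log (1 + 2 / (D + 2)) ≤ 2 := by
        have := Real.log_le_sub_one_of_pos (x := 1 + 2 / (D + 2)) (by linarith)
        linarith
      exact (one_le_div (Real.log_pos (by linarith))).2 h8
    have h9 : Real.log r ≤ Real.log r ^ radiusExponent D := by
      simpa using Real.rpow_le_rpow_of_exponent_le (by linarith : 1 ≤ Real.log r) hp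
    exact ⟨by linarith, h.2, by linarith⟩
  · exact ⟨by linarith, by linarith, by linarith⟩

lemma le_ofReal_exp_of_log_le {a : ℝ≥0∞} {x : ℝ} (h : ENNReal.log a ≤ (x : EReal)) :
    a ≤ ENNReal.ofReal (Real.exp x) := by
  have h1 : ENNReal.log a ≤ ENNReal.log (ENNReal.ofReal (Real.exp x)) := by
    rw [ENNReal.log_ofReal_of_pos (Real.exp_pos x), Real.log_exp]
    exact h
  exact ENNReal.log_le_log_iff.1 h1

/-- What the lower bound on the dimension gives: control of the doubling and heat kernel constants
on `[r', r]`, and of the weights, up to the factor `γ eⁿ`. -/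
lemma dimBound_spec {X : Type*} {G : WeightedGraph X} {ρ : X → X → ℝ} {o : X}
    {Ψ : X → ℝ → ℝ} {Φ : X → ℝ → ℝ → ℝ} {γ : ℝ → ℝ} {D r' r n : ℝ}
    (hball : ∀ x r, (metricBall ρ x r).Finite) (ho : ρ o o = 0) (hr' : 0 < r') (hr : r' < r)
    (hγ : 1 ≤ γ r) (hΨ : 1 ≤ Ψ o r) (hΦ : 1 ≤ Φ o r r)
    (h : dimBound G ρ o Ψ Φ γ D r' r ≤ (n : EReal)) :
    D ≤ n ∧
    (∃ P Q : ℝ, 1 ≤ P ∧ 1 ≤ Q ∧ P ^ 2 * Q ^ 3 ≤ γ r * Real.exp n ∧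
      ∀ x ∈ metricBall ρ o r, ∀ σ ∈ Set.Icc r' r, Ψ x σ ≤ P ∧ Φ x r σ ≤ Q) ∧
    ∀ x ∈ metricBall ρ o r, 1 / G.m x ≤ γ r / G.vol (metricBall ρ o r) * (r / r') ^ n := by
  have hγ0 : 0 < γ r := by linarith
  have hr0 : 0 < r := hr'.trans hr
  have ho' : o ∈ metricBall ρ o r := by
    change ρ o o ≤ r; rw [ho]; exact hr0.le
  unfold dimBound at h
  obtain ⟨h1, h2⟩ := max_le_iff.1 h
  obtain ⟨-, h3⟩ := max_le_iff.1 (le_ofReal_exp_of_log_le h2)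
  obtain ⟨h4, h5⟩ := max_le_iff.1 h3
  refine ⟨EReal.coe_le_coe_iff.1 h1, ?_, fun x hx => ?_⟩
  · set a := supNorm (fun q : X × ℝ => Ψ q.1 q.2) (metricBall ρ o r ×ˢ Set.Icc r' r) with ha
    set b := supNorm (fun q : X × ℝ => Φ q.1 r q.2) (metricBall ρ o r ×ˢ Set.Icc r' r) with hb
    have hmem : (o, r) ∈ metricBall ρ o r ×ˢ Set.Icc r' r := ⟨ho', hr.le, le_rfl⟩
    have ha1 : 1 ≤ a := by
      refine le_trans ?_ (ofReal_le_supNorm (f := fun q : X × ℝ => Ψ q.1 q.2) hmem)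
      simpa using hΨ
    have hb1 : 1 ≤ b := by
      refine le_trans ?_ (ofReal_le_supNorm (f := fun q : X × ℝ => Φ q.1 r q.2) hmem)
      simpa using hΦ
    have h6 : a ^ 10 * b ^ 10 ≤ ENNReal.ofReal (γ r * Real.exp n) := by
      rw [mul_comm (γ r), ENNReal.ofReal_mul (Real.exp_pos n).le]
      exact (ENNReal.div_le_iff (by simpa using hγ0) ENNReal.ofReal_ne_top).1 h4
    have h7 : a ^ 2 * b ^ 3 ≤ ENNReal.ofReal (γ r * Real.exp n) :=
      (mul_le_mul' (pow_le_pow_right₀ ha1 (by norm_num))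
        (pow_le_pow_right₀ hb1 (by norm_num))).trans h6
    have haT : a ≠ ⊤ := by
      refine ne_top_of_le_ne_top (ENNReal.ofReal_ne_top (r := γ r * Real.exp n))
        (le_trans ?_ h7)
      calc a ≤ a ^ 2 := le_self_pow₀ ha1 two_ne_zero
        _ ≤ a ^ 2 * b ^ 3 := le_mul_of_one_le_right' (one_le_pow₀ hb1)
    have hbT : b ≠ ⊤ := by
      refine ne_top_of_le_ne_top (ENNReal.ofReal_ne_top (r := γ r * Real.exp n))
        (le_trans ?_ h7)
      calc b ≤ b ^ 3 := le_self_pow₀ hb1 three_ne_zero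
        _ ≤ a ^ 2 * b ^ 3 := le_mul_of_one_le_left' (one_le_pow₀ ha1)
    refine ⟨a.toReal, b.toReal, ?_, ?_, ?_, fun x hx σ hσ => ⟨?_, ?_⟩⟩
    · simpa using ENNReal.toReal_mono haT ha1
    · simpa using ENNReal.toReal_mono hbT hb1
    · have := ENNReal.toReal_mono ENNReal.ofReal_ne_top h7
      rwa [ENNReal.toReal_mul, ENNReal.toReal_pow, ENNReal.toReal_pow,
        ENNReal.toReal_ofReal (by positivity)] at this
    · exact le_toReal_supNorm (f := fun q : X × ℝ => Ψ q.1 q.2) haT (a := (x, σ)) ⟨hx, hσ⟩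
    · exact le_toReal_supNorm (f := fun q : X × ℝ => Φ q.1 r q.2) hbT (a := (x, σ)) ⟨hx, hσ⟩
  · set V := G.vol (metricBall ρ o r) with hV
    have hV0 : 0 < V := G.vol_pos (hball o r) ⟨o, ho'⟩
    have hm := G.m_pos x
    have hlog : 0 < Real.log (r / r') := Real.log_pos ((one_lt_div hr').2 hr)
    have h6 : ENNReal.ofReal ((V * (1 / G.m x) / γ r) ^ (1 / Real.log (r / r'))) ≤
        ENNReal.ofReal (Real.exp n) := by
      refine le_trans ?_ h5
      rw [← ENNReal.ofReal_rpow_of_pos (by positivity), ENNReal.ofReal_div_of_pos hγ0,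
        ENNReal.ofReal_mul hV0.le]
      refine ENNReal.rpow_le_rpow ?_ (by positivity)
      gcongr
      exact ofReal_le_supNorm (f := fun x => 1 / G.m x) hx
    -- `(M / γ) ^ (1 / log (r / r')) ≤ eⁿ` is the same as `M / γ ≤ (r / r') ^ n`
    rw [ENNReal.ofReal_le_ofReal_iff (Real.exp_pos n).le, one_div (Real.log _),
      Real.rpow_inv_le_iff_of_pos (by positivity) (Real.exp_pos n).le hlog,
      ← Real.exp_mul, mul_comm n, Real.exp_mul, Real.exp_log (by positivity)] at h6
    rw [div_le_iff₀ hγ0] at h6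
    rw [div_mul_eq_mul_div, le_div_iff₀ hV0]
    linarith

lemma two_lt_dimSup {X : Type*} {ρ : X → X → ℝ} {o : X} {d : X → ℝ → ℝ} {r : ℝ}
    (hfin : (metricBall ρ o r).Finite) (ho : o ∈ metricBall ρ o r) (hd : 2 < d o r) :
    2 < dimSup ρ o d r :=
  hd.trans_le (le_toReal_supNorm (f := fun x => d x r) (supNorm_lt_top _ hfin).ne ho)

theorem mainTheorem7 {X : Type*} [Countable X] (G : WeightedGraph X) (ρ : X → X → ℝ)
    (hρ : G.IsIntrinsicMetric ρ) (hpath : G.IsPathMetric ρ)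
    (hball : ∀ x r, (metricBall ρ x r).Finite) (hjump : G.maxJump ρ < ⊤)
    (o : X) (R₁ R₂ : ℝ) (hR₁ : 0 ≤ R₁) (hR₂ : 4 * R₁ ≤ R₂)
    (hs : ∀ r ∈ Set.Icc R₁ R₂,
      8 * ⨆ x ∈ metricBall ρ o r, G.jumpSize ρ x (r / 4) ≤ ENNReal.ofReal r)
    (Ψ N d : X → ℝ → ℝ) (Φ : X → ℝ → ℝ → ℝ)
    (hΨ : ∀ x, ∀ r ∈ Set.Icc R₁ R₂, 1 ≤ Ψ x r)
    (hΦ : ∀ x, ∀ r₂ ∈ Set.Icc R₁ R₂, ∀ r₁ ∈ Set.Icc R₁ R₂, 1 ≤ Φ x r₂ r₁)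
    (hN : ∀ x, ∀ r ∈ Set.Icc R₁ R₂, 2 < N x r)
    (hd : ∀ x, ∀ r ∈ Set.Icc R₁ R₂, 2 < d x r)
    (hG : G.GaussianBounds ρ Ψ N R₁ R₂ (metricBall ρ o R₂))
    (hV : G.VolumeDoubling ρ Φ d R₁ R₂ (metricBall ρ o R₂))
    (γ : ℝ → ℝ) (hγ : ∀ r ∈ Set.Icc (4 * R₁) R₂, 1 ≤ γ r)
    (n : ℝ → ℝ)
    (hn : ∀ r ∈ Set.Icc (4 * R₁) R₂,
      dimBound G ρ o Ψ Φ γ (dimSup ρ o d r) (innerRadius R₁ (dimSup ρ o d r) r) r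
        ≤ (n r : EReal)) :
    G.Sobolev ρ
      (fun _ r => 2 ^ (49 + 2 * dimSup ρ o d r / (dimSup ρ o d r - 2)) *
        γ r ^ (2 / dimSup ρ o d r))
      (fun _ r => n r) (4 * R₁) R₂ {o} := by
  intro x hx r hr hr0 u hu
  obtain rfl : x = o := hx
  rename' x => o
  have hrR : r ∈ Set.Icc R₁ R₂ := ⟨by linarith [hr.1], hr.2⟩
  have ho : o ∈ metricBall ρ o r := by
    change ρ o o ≤ r; rw [hρ.self]; exact hr0.le
  set D := dimSup ρ o d r with hDdef
  have hD : 2 < D := two_lt_dimSup (hball o r) ho (hd o r hrR)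
  obtain ⟨hr'0, hr'r, hR₁r'⟩ := innerRadius_spec (R₁ := R₁) hD hr0 hr.1
  have hn' := hn r hr
  have hγ1 := hγ r hr
  rw [← hDdef] at hn'
  set r' := innerRadius R₁ D r with hr'def
  obtain ⟨hDn, ⟨P, Q, hP1, hQ1, hPQ, hPQb⟩, hmb⟩ := dimBound_spec hball (hρ.self o) hr'0 hr'r
    hγ1 (hΨ o r hrR) (hΦ o r hrR r hrR) hn'
  set V := G.vol (metricBall ρ o r) with hVdef
  have hV0 : 0 < V := G.vol_pos (hball o r) ⟨o, ho⟩
  have hγ0 : 0 < γ r := by linarith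
  set ν := n r with hν
  have hν2 : 2 < ν := hD.trans_le hDn
  have hloc := WeightedGraph.finite_neighbors hball hjump
  have hedge : ∀ y z, ρ o y ≤ r → 0 < G.b y z → ρ y z ≤ r / 8 := by
    intro y z hy hyz
    have h1 : ENNReal.ofReal (8 * ρ y z) ≤ ENNReal.ofReal r := by
      refine le_trans ?_ (hs r hrR)
      rw [ENNReal.ofReal_mul (by norm_num), ENNReal.ofReal_ofNat]
      refine mul_le_mul_right ?_ _
      exact le_iSup₂_of_le y hy (WeightedGraph.ofReal_le_jumpSize hyz _)
    rw [ENNReal.ofReal_le_ofReal_iff hr0.le] at h1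
    linarith
  have hdoub : ∀ z, ρ o z ≤ r → ∀ σ, r' ≤ σ → σ ≤ r →
      G.vol (metricBall ρ z r) ≤ Q * (r / σ) ^ D * G.vol (metricBall ρ z σ) := by
    intro z hz σ hσ' hσ
    have hσ0 : 0 < σ := hr'0.trans_le hσ'
    refine (hV z (le_trans hz hr.2) σ r hσ0 (hR₁r'.trans hσ') hσ hr.2).trans ?_
    have hdz : d z r ≤ D :=
      le_toReal_supNorm (f := fun x => d x r) (supNorm_lt_top _ (hball o r)).ne hz
    refine mul_le_mul_of_nonneg_right ?_ (tsum_nonneg fun y => (G.m_pos y).le)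
    exact mul_le_mul (hPQb z hz σ ⟨hσ', hσ⟩).2
      (Real.rpow_le_rpow_of_exponent_le ((one_le_div hσ0).2 hσ) hdz)
      (by positivity) (by linarith)
  -- `32 ≥ 8 e`, where `8` comes from comparing volumes of balls and `e` from the bound `γ eⁿ`
  set k := γ r * 32 ^ ν / V with hk
  have hk0 : 0 < k := by positivity
  have hker : ∀ y ∈ metricBall ρ o r, ∀ t, 0 < t → t ≤ r ^ 2 →
      1 / G.m y ≤ k * (r ^ 2 / t) ^ (ν / 2) ∨
      G.heatKernel t y y ≤ ENNReal.ofReal (k * (r ^ 2 / t) ^ (ν / 2)) := by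
    intro y hy t ht htr
    have hst : 0 < Real.sqrt t := Real.sqrt_pos.2 ht
    have hstr : Real.sqrt t ≤ r := Real.sqrt_le_iff.2 ⟨hr0.le, htr⟩
    have hpow : (r ^ 2 / t) ^ (ν / 2) = (r / Real.sqrt t) ^ ν := by
      rw [← Real.sq_sqrt ht.le, ← div_pow, Real.sqrt_sq hst.le, ← Real.rpow_natCast,
        ← Real.rpow_mul (by positivity)]
      congr 1
      push_cast
      ring
    have hone : 1 ≤ r / Real.sqrt t := (one_le_div hst).2 hstr
    rw [hpow]
    -- up to the radius `r'`, or if `r'` is comparable to `r`, the trivial bound suffices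
    have htriv : r / r' ≤ 32 * (r / Real.sqrt t) →
        1 / G.m y ≤ k * (r / Real.sqrt t) ^ ν := by
      intro h
      refine (hmb y hy).trans ?_
      have h1 : (r / r') ^ ν ≤ 32 ^ ν * (r / Real.sqrt t) ^ ν := by
        rw [← Real.mul_rpow (by norm_num) (by positivity)]
        exact Real.rpow_le_rpow (by positivity) h (by linarith)
      calc _ ≤ γ r / V * (32 ^ ν * (r / Real.sqrt t) ^ ν) :=
            mul_le_mul_of_nonneg_left h1 (by positivity)
        _ = _ := by rw [hk]; ring
    rcases le_or_gt (Real.sqrt t) r' with hcase | hcase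
    · left
      refine htriv ?_
      have h1 : r / r' ≤ r / Real.sqrt t := div_le_div_of_nonneg_left hr0.le hst hcase
      linarith
    rcases lt_or_ge (r / 4) r' with hcase2 | hcase2
    · left
      refine htriv ?_
      have h1 : r / r' ≤ 4 := (div_le_iff₀ hr'0).2 (by linarith)
      linarith
    right
    -- here all radii in `[r / 4, r]` are admissible in the doubling estimates
    have hvol_pos : ∀ s, 0 < s → 0 < G.vol (metricBall ρ y s) := fun s hs0 =>
      G.vol_pos (hball y s) ⟨y, by change ρ y y ≤ s; rw [hρ.self]; exact hs0.le⟩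
    have hR₂0 : 0 ≤ R₂ := hr0.le.trans hr.2
    refine (hG.heatKernel_diag_le hρ ht hR₂0 ?_ ?_ (le_trans hy hr.2)
      (hvol_pos _ hst).le).trans (ENNReal.ofReal_le_ofReal ?_)
    · exact (Real.le_sqrt hR₁ ht.le).1 (hR₁r'.trans hcase.le)
    · exact htr.trans (pow_le_pow_left₀ hr0.le hr.2 2)
    have hv1 : V ≤ Q ^ 2 * 8 ^ D * G.vol (metricBall ρ y r) :=
      WeightedGraph.vol_ball_le hρ hpath hball hr0 (by linarith) hedge
        (fun z hz σ h1 h2 => hdoub z hz σ (hcase2.trans h1) h2) hy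
    have hv2 := hdoub y hy _ hcase.le hstr
    have hΨP := (hPQb y hy (Real.sqrt t) ⟨hcase.le, hstr⟩).1
    have hΨ0 : 0 ≤ Ψ y (Real.sqrt t) :=
      zero_le_one.trans (hΨ y _ ⟨hR₁r'.trans hcase.le, hstr.trans hr.2⟩)
    set W := G.vol (metricBall ρ y (Real.sqrt t)) with hW
    have hW0 : 0 < W := hvol_pos _ hst
    have hexp : Real.exp ν * 8 ^ ν ≤ 32 ^ ν := by
      have h1 : Real.exp ν ≤ 4 ^ ν := by
        rw [← Real.exp_one_rpow]
        exact Real.rpow_le_rpow (Real.exp_pos 1).le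
          (by linarith [Real.exp_one_lt_d9]) (by linarith)
      calc _ ≤ (4 : ℝ) ^ ν * 8 ^ ν := mul_le_mul_of_nonneg_right h1 (by positivity)
        _ = 32 ^ ν := by rw [← Real.mul_rpow (by norm_num) (by norm_num)]; norm_num
    have h8 : (8 : ℝ) ^ D ≤ 8 ^ ν := Real.rpow_le_rpow_of_exponent_le (by norm_num) hDn
    have h9 : (r / Real.sqrt t) ^ D ≤ (r / Real.sqrt t) ^ ν :=
      Real.rpow_le_rpow_of_exponent_le hone hDn
    rw [hk, div_mul_eq_mul_div, div_le_div_iff₀ hW0 hV0]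
    have hVW : V ≤ Q ^ 3 * (8 ^ ν * (r / Real.sqrt t) ^ ν) * W := by
      calc V ≤ Q ^ 2 * 8 ^ D * (Q * (r / Real.sqrt t) ^ D * W) :=
            hv1.trans (mul_le_mul_of_nonneg_left hv2 (by positivity))
        _ = Q ^ 3 * (8 ^ D * (r / Real.sqrt t) ^ D) * W := by ring
        _ ≤ _ := by gcongr
    calc Ψ y (Real.sqrt t) ^ 2 * V
        ≤ P ^ 2 * (Q ^ 3 * (8 ^ ν * (r / Real.sqrt t) ^ ν) * W) := by gcongr
      _ = P ^ 2 * Q ^ 3 * (8 ^ ν * (r / Real.sqrt t) ^ ν * W) := by ring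
      _ ≤ γ r * Real.exp ν * (8 ^ ν * (r / Real.sqrt t) ^ ν * W) := by gcongr
      _ = γ r * (Real.exp ν * 8 ^ ν) * ((r / Real.sqrt t) ^ ν * W) := by ring
      _ ≤ γ r * 32 ^ ν * ((r / Real.sqrt t) ^ ν * W) := by gcongr
      _ = _ := by ring
  have hsob := WeightedGraph.sobolev_of_heatKernel_bound hloc (hball o r) hν2 hr0 hk0 hker hu
  set E := G.lpNorm 2 (G.gradNorm u) ^ 2 + 1 / r ^ 2 * G.lpNorm 2 u ^ 2 with hE
  have hE0 : 0 ≤ E := by positivity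
  have hν0 : 0 < ν := by linarith
  have hkpow : (2 * k) ^ (2 / ν) = 2 ^ (2 / ν) * γ r ^ (2 / ν) * 1024 / V ^ (2 / ν) := by
    rw [hk, ← mul_div_assoc, Real.div_rpow (by positivity) hV0.le, ← mul_assoc,
      Real.mul_rpow (by positivity) (by positivity), Real.mul_rpow two_pos.le hγ0.le,
      ← Real.rpow_mul (by norm_num : (0 : ℝ) ≤ 32), show ν * (2 / ν) = 2 by field_simp]
    norm_num
  have hq : 2 * ν / (ν - 2) ≤ 2 * D / (D - 2) := by
    rw [div_le_div_iff₀ (by linarith) (by linarith)]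
    nlinarith
  have hc1 : (2 : ℝ) ^ (2 / ν) ≤ 2 := by
    simpa using Real.rpow_le_rpow_of_exponent_le (one_le_two (α := ℝ))
      ((div_le_one hν0).2 hν2.le)
  have hc2 : γ r ^ (2 / ν) ≤ γ r ^ (2 / D) :=
    Real.rpow_le_rpow_of_exponent_le hγ1 (div_le_div_of_nonneg_left two_pos.le (by linarith) hDn)
  have hc3 : (2 : ℝ) ^ (2 * ν / (ν - 2)) ≤ 2 ^ (2 * D / (D - 2)) :=
    Real.rpow_le_rpow_of_exponent_le one_le_two hq
  change V ^ (2 / ν) / (2 ^ (49 + 2 * D / (D - 2)) * γ r ^ (2 / D) * r ^ 2) *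
    G.lpNorm (2 * ν / (ν - 2)) u ^ 2 ≤ E
  have hφ : (2 : ℝ) ^ (49 + 2 * D / (D - 2)) = 2 ^ 49 * 2 ^ (2 * D / (D - 2)) := by
    rw [Real.rpow_add two_pos]
    norm_num
  rw [div_mul_eq_mul_div, div_le_iff₀ (by positivity), hφ]
  have hVpow : 0 < V ^ (2 / ν) := by positivity
  calc V ^ (2 / ν) * G.lpNorm (2 * ν / (ν - 2)) u ^ 2
      ≤ V ^ (2 / ν) * (4 * 2 ^ (2 * ν / (ν - 2)) * (r ^ 2 * (2 * k) ^ (2 / ν)) * E) :=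
        mul_le_mul_of_nonneg_left hsob hVpow.le
    _ = 4096 * (2 ^ (2 * ν / (ν - 2)) * (2 ^ (2 / ν) * γ r ^ (2 / ν)) * r ^ 2) * E := by
        rw [hkpow]; field_simp; ring
    _ ≤ 4096 * (2 ^ (2 * D / (D - 2)) * (2 * γ r ^ (2 / D)) * r ^ 2) * E := by gcongr
    _ = 8192 * (E * (2 ^ (2 * D / (D - 2)) * γ r ^ (2 / D) * r ^ 2)) := by ring
    _ ≤ 2 ^ 49 * (E * (2 ^ (2 * D / (D - 2)) * γ r ^ (2 / D) * r ^ 2)) :=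
        mul_le_mul_of_nonneg_right (by norm_num) (by positivity)
    _ = _ := by ring
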